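/- Setting. Let $\Gamma$ be a finite dynamic game with perfect recall, possibly with simultaneous moves, with player set $I$, set of terminal histories (outcomes) $Z$, information sets $H_i$ and an ordinal (complete and transitive) preference relation $\succsim_i$ on $Z$ for each player $i$. Let $S_i$ be the set of strategies of $i$ (classes of behaviorally equivalent standard strategies, i.e. reduced strategies), $S=\prod_j S_j$, $S_{-i}=\prod_{j\ne i}S_j$, and $\zeta:S\to Z$ the outcome function. For $h\in H_i$, let $S_i(h)$ and $S_{-i}(h)$ be the projections on $S_i$ and $S_{-i}$ of the set of strategy profiles that reach $h$, and let $H_i(s_i)=\{h\in H_i : s_i\in S_i(h)\}$. A restriction is a nonempty product set $R=\prod_j R_j\subseteq S$; with $R_{-i}=\prod_{j\neq i}R_j$ put $R_i(h)=R_i\cap S_i(h)$, $R_{-i}(h)=R_{-i}\cap S_{-i}(h)$, $R^i(h)=R_i(h)\times R_{-i}(h)$. Let $\mathcal U_i$ be the set of Bernoulli utility functions $u_i:Z\to\mathbb R$ with $u_i(z)\ge u_i(z')\iff z\succsim_i z'$. Operators. For $P\subseteq S_i$ and $Q\subseteq S_{-i}$, a strategy $s_i\in P$ is weakly dominated relative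 to $P\times Q$ if some $t_i\in P$ satisfies $\zeta(t_i,q)\succsim_i\zeta(s_i,q)$ for all $q\in Q$, with strict preference for some $q\in Q$. It is B-dominated with respect to $P\times Q$ if for every nonempty $Q'\subseteq Q$ it is weakly dominated relative to $P\times Q'$. - $\mathbb U_i(R)$ is the set of $s_i\in R_i$ such that for every $h\in H_i(s_i)$ with $R^i(h)\neq\emptyset$, $s_i$ is not B-dominated with respect to $R^i(h)$; $\mathbb U(R)=\prod_j\mathbb U_j(R)$. - $\mathbb M_i(R)[u_i]$ is the set of $s_i\in R_i$ such that for every $h\in H_i(s_i)$ with $R^i(h)\ne\emptyset$ there is no mixed strategy $\sigma_i\in\Delta(R_i(h))$ with $\sum_{t_i}\sigma_i(t_i)u_i(\zeta(t_i,q))>u_i(\zeta(s_i,q))$ for all $q\in R_{-i}(h)$. - A conditional probability system (CPS) of $i$ is a family of probability measures $\mu_i(\cdot|C)$ on $S_{-i}$, indexed by the conditioning events $C\in\{S_{-i}(h):h\in H_i\}$, with $\mu_i(C|C)=1$ and $\mu_i(E|C)=\mu_i(E|D)\,\mu_i(D|C)$ for all conditioning events $C,D$ and all $E\subseteq D\subseteq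 C$. Let $\Delta^{\mathcal H_i}(R_{-i})$ be the set of CPSs with $\mu_i(R_{-i}(h)|S_{-i}(h))=1$ for every $h\in H_i$ with $R^i(h)\neq\emptyset$. - $\mathbb R_i(R)[u]$ is the set of $s_i\in R_i$ for which there is $\mu_i\in\Delta^{\mathcal H_i}(R_{-i})$ such that for every $h\in H_i(s_i)$ with $R^i(h)\ne\emptyset$, $s_i$ maximizes $\sum_{q\in S_{-i}}u_i(\zeta(t_i,q))\,\mu_i(\{q\}|S_{-i}(h))$ over $t_i\in S_i(h)$; $\mathbb R(R)[u]=\prod_j\mathbb R_j(R)[u]$, for a profile $u=(u_j)_{j\in I}$. For $k\ge0$, $\mathbb U^k(S)$ (Iterative Conditional B-Dominance, ICBD) and $\mathbb R^k(S)[u]$ (Strong Rationalizability under $u$) are the results of applying $\mathbb U$, respectively $\mathbb R(\cdot)[u]$ (with the same $u$ in every round), $k$ times to $S$; $\mathbb U^\infty(S)$ and $\mathbb R^\infty(S)[u]$ are the intersections over all $k$. A subscript $i$ denotes the $i$-th factor. Theorem. 1. For every restriction $R$ and every player $i$, $\ \mathbb U_i(R)=\bigcup_{u_i\in\mathcal U_i}\mathbb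 M_i(R)[u_i]$. 2. For every $k\in\mathbb N$ there is a profile $u^k=(u^k_j)_{j\in I}$ with $u^k_j\in\mathcal U_j$ for every $j$ such that $\mathbb U^k(S)=\mathbb R^k(S)[u^k]$, and $\mathbb U^k_i(S)=\mathbb R^k_i(S)[u^k]$ for every player $i$. 3. There is a profile $u^\infty$ with $u^\infty_j\in\mathcal U_j$ for every $j$ such that $\mathbb U^\infty(S)=\mathbb R^\infty(S)[u^\infty]$, and $\mathbb U^\infty_i(S)=\mathbb R^\infty_i(S)[u^\infty]$ for every player $i$. -/

import Mathlib

/-- The arborescence of a finite dynamic game. A history is a finite sequence of action profiles;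
`x ++ [a]` is the history `x` followed by the profile `a`, and precedence is the initial-segment
relation `<+:`. -/
structure GameTree (I : Type*) (A : I → Type*) where
  /-- the set `X` of histories -/
  hist : Set (List (∀ i, A i))
  hist_finite : hist.Finite
  nil_mem : [] ∈ hist
  mem_of_snoc : ∀ x a, x ++ [a] ∈ hist → x ∈ hist
  /-- the profiles that may follow a history form a product `A(x) = ∏ i, A_i(x)` -/
  snoc_mem : ∀ x ∈ hist, ∀ b : (∀ i, A i),
    (∀ i, ∃ a : (∀ i, A i), x ++ [a] ∈ hist ∧ a i = b i) → x ++ [b] ∈ hist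

namespace GameTree

variable {I : Type*} {A : I → Type*} (T : GameTree I A)

/-- `A_i(x)`: the actions available to player `i` at `x`. -/
def avail (x : List (∀ i, A i)) (i : I) : Set (A i) :=
  {b | ∃ a : (∀ i, A i), x ++ [a] ∈ T.hist ∧ a i = b}

/-- `Z`: the histories after which no action profile is available. -/
def terminal : Set (List (∀ i, A i)) :=
  {z | z ∈ T.hist ∧ ∀ a, z ++ [a] ∉ T.hist}

/-- Player `i` is active at `x`: at least two actions are available to her. -/
def Active (i : I) (x : List (∀ i, A i)) : Prop :=
  x ∈ T.hist ∧ (T.avail x i).Nontrivial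

theorem mem_of_isPrefix_mem {x z : List (∀ i, A i)} (hxz : x <+: z) (hz : z ∈ T.hist) :
    x ∈ T.hist := by
  induction z using List.reverseRecOn with
  | nil => rwa [List.prefix_nil.mp hxz]
  | append_singleton z a ih =>
    rcases List.prefix_concat_iff.mp hxz with h | h
    · rwa [h]
    · exact ih h (T.mem_of_snoc z a hz)

end GameTree

/-- A finite dynamic game with ordinal preferences and perfect recall. -/
structure DynamicGame (I : Type*) (A : I → Type*) extends GameTree I A where
  /-- `H_i`: a partition of the histories at which player `i` is active -/
  infoSets : I → Set (Set (List (∀ i, A i)))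
  info_nonempty : ∀ i, ∀ h ∈ infoSets i, h.Nonempty
  info_active : ∀ i, ∀ h ∈ infoSets i, ∀ x ∈ h, toGameTree.Active i x
  info_partition : ∀ i x, toGameTree.Active i x → ∃! h, h ∈ infoSets i ∧ x ∈ h
  info_avail : ∀ i, ∀ h ∈ infoSets i, ∀ x ∈ h, ∀ y ∈ h,
    toGameTree.avail x i = toGameTree.avail y i
  /-- perfect recall: if some history in `h` comes after the choice of the action `a i` at the
  information set `g` of the same player, then so does every history in `h` -/
  perfect_recall : ∀ i, ∀ g ∈ infoSets i, ∀ h ∈ infoSets i, ∀ x ∈ h, ∀ x' ∈ h,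
    ∀ y ∈ g, ∀ a : (∀ i, A i), y ++ [a] <+: x →
      ∃ y' ∈ g, ∃ a' : (∀ i, A i), y' ++ [a'] <+: x' ∧ a' i = a i
  /-- `pref i z z'` is `z ≿_i z'` -/
  pref : I → toGameTree.terminal → toGameTree.terminal → Prop
  pref_total : ∀ i z z', pref i z z' ∨ pref i z' z
  pref_trans : ∀ i z z' z'', pref i z z' → pref i z' z'' → pref i z z''

namespace DynamicGame

variable {I : Type*} {A : I → Type*} (G : DynamicGame I A)

/-- `Z` as a type. -/
abbrev Outcome : Type _ := G.toGameTree.terminal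

/-- `z ≻_i z'`. -/
def StrictPref (i : I) (z z' : G.Outcome) : Prop := G.pref i z z' ∧ ¬ G.pref i z' z

/-- `A_i(h)`: the actions available at the histories of an information set. -/
def availAt (i : I) (h : Set (List (∀ i, A i))) : Set (A i) := {b | ∃ x ∈ h, b ∈ G.avail x i}

/-- Standard strategies: a choice of an available action at every information set. -/
def StdStrategy (i : I) : Type _ := ∀ h : G.infoSets i, G.availAt i h.1

/-- Every action taken along `z` by a player active there is the one prescribed by `s`. -/
def Follows (s : ∀ i, G.StdStrategy i) (z : List (∀ i, A i)) : Prop :=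
  ∀ (x : List (∀ i, A i)) (a : ∀ i, A i), x ++ [a] <+: z →
    ∀ (i : I) (h : G.infoSets i), x ∈ h.1 → (s i h : A i) = a i

theorem exists_follows (s : ∀ i, G.StdStrategy i) : ∃ z : G.Outcome, G.Follows s z.1 := by
  classical
  have hfin : {x | x ∈ G.hist ∧ G.Follows s x}.Finite := G.hist_finite.subset fun x hx => hx.1
  have hne : {x | x ∈ G.hist ∧ G.Follows s x}.Nonempty :=
    ⟨[], G.nil_mem, fun x a h => by simp at h⟩
  obtain ⟨x, ⟨hx, hxs⟩, hmax⟩ := Set.exists_max_image _ List.length hfin hne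
  refine ⟨⟨x, hx, fun a₀ ha₀ => ?_⟩, hxs⟩
  have key : ∀ i, ∃ b : A i, b ∈ G.avail x i ∧
      ∀ h : G.infoSets i, x ∈ h.1 → (s i h : A i) = b := by
    intro i
    by_cases hi : G.toGameTree.Active i x
    · obtain ⟨h, ⟨hh, hxh⟩, huniq⟩ := G.info_partition i x hi
      obtain ⟨y, hy, hb⟩ := (s i ⟨h, hh⟩).2
      refine ⟨(s i ⟨h, hh⟩ : A i), ?_, ?_⟩
      · rw [G.info_avail i h hh x hxh y hy]
        exact hb
      · intro h' hxh'
        have e : h' = ⟨h, hh⟩ := Subtype.ext (huniq h'.1 ⟨h'.2, hxh'⟩)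
        rw [e]
    · exact ⟨a₀ i, ⟨a₀, ha₀, rfl⟩, fun h hxh => absurd (G.info_active i h.1 h.2 x hxh) hi⟩
  choose b hb hbs using key
  have hmem : x ++ [b] ∈ G.hist := G.snoc_mem x hx b hb
  have hfol : G.Follows s (x ++ [b]) := by
    intro y a hya i h hyh
    rcases List.prefix_concat_iff.mp hya with h1 | h1
    · obtain ⟨rfl, h2⟩ := List.append_inj' h1 rfl
      obtain rfl : a = b := by simpa using h2
      exact hbs i h hyh
    · exact hxs y a h1 i h hyh
  have := hmax _ ⟨hmem, hfol⟩
  simp at this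

theorem follows_isPrefix {s : ∀ i, G.StdStrategy i} {z z' : G.Outcome}
    (hz : G.Follows s z.1) (hz' : G.Follows s z'.1) :
    ∀ x : List (∀ i, A i), x <+: z.1 → x <+: z'.1 := by
  intro x
  induction x using List.reverseRecOn with
  | nil => intro _; exact List.nil_prefix
  | append_singleton x a ih =>
    intro hxa
    have hmem : x ++ [a] ∈ G.hist := G.mem_of_isPrefix_mem hxa z.2.1
    obtain ⟨t, ht⟩ := ih ((List.prefix_append x [a]).trans hxa)
    cases t with
    | nil =>
      have hzx : z'.1 = x := by simpa using ht.symm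
      exact absurd hmem (hzx ▸ z'.2.2 a)
    | cons a' t =>
      have hpre : x ++ [a'] <+: z'.1 := ⟨t, by simpa using ht⟩
      have hmem' : x ++ [a'] ∈ G.hist := G.mem_of_isPrefix_mem hpre z'.2.1
      have : a = a' := by
        funext i
        by_cases hi : G.toGameTree.Active i x
        · obtain ⟨h, ⟨hh, hxh⟩, -⟩ := G.info_partition i x hi
          rw [← hz x a hxa i ⟨h, hh⟩ hxh, ← hz' x a' hpre i ⟨h, hh⟩ hxh]
        · have hx : x ∈ G.hist := G.mem_of_snoc x a hmem
          have hs : (G.avail x i).Subsingleton :=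
            Set.not_nontrivial_iff.mp fun hn => hi ⟨hx, hn⟩
          exact hs ⟨a, hmem, rfl⟩ ⟨a', hmem', rfl⟩
      rwa [this]

theorem follows_unique {s : ∀ i, G.StdStrategy i} {z z' : G.Outcome}
    (hz : G.Follows s z.1) (hz' : G.Follows s z'.1) : z = z' :=
  Subtype.ext (List.IsPrefix.eq_of_length_le (G.follows_isPrefix hz hz' _ List.prefix_rfl)
    (G.follows_isPrefix hz' hz _ List.prefix_rfl).length_le)

/-- The outcome function on profiles of standard strategies: the unique terminal history along
which the players follow `s`. -/
noncomputable def stdOutcome (s : ∀ i, G.StdStrategy i) : G.Outcome := (G.exists_follows s).choose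

theorem stdOutcome_eq_iff (s : ∀ i, G.StdStrategy i) (z : G.Outcome) :
    G.stdOutcome s = z ↔ G.Follows s z.1 :=
  ⟨fun h => h ▸ (G.exists_follows s).choose_spec,
    fun h => G.follows_unique (G.exists_follows s).choose_spec h⟩

/-- The standard strategies of player `i` that reach the history `x`. -/
def stdReachHist (i : I) (x : List (∀ i, A i)) : Set (G.StdStrategy i) :=
  {si | ∃ s : (∀ j, G.StdStrategy j), s i = si ∧ x <+: (G.stdOutcome s).1}

/-- The standard strategies of player `i` that reach the set of histories `h`. -/
def stdReach (i : I) (h : Set (List (∀ i, A i))) : Set (G.StdStrategy i) :=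
  ⋃ x ∈ h, G.stdReachHist i x

/-- The information sets (of any player) allowed by a standard strategy of player `i`. -/
def stdAllowed (i : I) (si : G.StdStrategy i) : Set (Set (List (∀ i, A i))) :=
  {h | (∃ j, h ∈ G.infoSets j) ∧ si ∈ G.stdReach i h}

/-- Behavioral equivalence of standard strategies. -/
def behavioralSetoid (i : I) : Setoid (G.StdStrategy i) where
  r s t := G.stdAllowed i s = G.stdAllowed i t ∧
    ∀ h : G.infoSets i, h.1 ∈ G.stdAllowed i s → s h = t h
  iseqv :=
    { refl := fun _ => ⟨rfl, fun _ _ => rfl⟩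
      symm := fun h => ⟨h.1.symm, fun k hk => (h.2 k (h.1 ▸ hk)).symm⟩
      trans := fun h h' => ⟨h.1.trans h'.1, fun k hk => (h.2 k hk).trans (h'.2 k (h.1 ▸ hk))⟩ }

/-- `S_i`: the strategies of player `i`, i.e. the classes of behaviorally equivalent standard
strategies. -/
def Strategy (i : I) : Type _ := Quotient (G.behavioralSetoid i)

/-- The outcome function `ζ` on profiles of strategies, computed from representatives
(see `outcome_mk`). -/
noncomputable def outcome (s : ∀ i, G.Strategy i) : G.Outcome :=
  G.stdOutcome fun i => Quotient.out (s i)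

/-- The outcome does not depend on the representatives. -/
theorem outcome_mk (s : ∀ i, G.StdStrategy i) :
    G.outcome (fun i => Quotient.mk (G.behavioralSetoid i) (s i)) = G.stdOutcome s := by
  symm
  rw [stdOutcome_eq_iff]
  set t : ∀ i, G.StdStrategy i :=
    fun i => Quotient.out (Quotient.mk (G.behavioralSetoid i) (s i)) with ht
  have hfol : G.Follows t (G.stdOutcome t).1 := (G.stdOutcome_eq_iff t _).mp rfl
  intro x a hxa i h hxh
  have hrel := Quotient.mk_out (s := G.behavioralSetoid i) (s i)
  have hreach : h.1 ∈ G.stdAllowed i (t i) := by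
    refine ⟨⟨i, h.2⟩, Set.mem_iUnion₂.mpr ⟨x, hxh, t, rfl, ?_⟩⟩
    exact (List.prefix_append x [a]).trans hxa
  rw [← hrel.2 h hreach]
  exact hfol x a hxa i h hxh

instance (i : I) : Finite (G.StdStrategy i) := by
  have hA : ∀ x : List (∀ i, A i), (G.avail x i).Finite := by
    intro x
    have hinj : ((fun a : (∀ i, A i) => x ++ [a]) ⁻¹' G.hist).Finite :=
      G.hist_finite.preimage (fun a _ b _ h => by simpa using h)
    refine (hinj.image fun a => a i).subset ?_
    rintro b ⟨a, ha, rfl⟩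
    exact ⟨a, ha, rfl⟩
  have hh : (G.infoSets i).Finite := by
    refine G.hist_finite.finite_subsets.subset fun h hh x hx => ?_
    exact (G.info_active i h hh x hx).1
  have : Finite (G.infoSets i) := hh
  have : ∀ h : G.infoSets i, Finite (G.availAt i h.1) := by
    intro h
    obtain ⟨x, hx⟩ := G.info_nonempty i h.1 h.2
    refine ((hA x).subset ?_ : (G.availAt i h.1).Finite)
    rintro b ⟨y, hy, hb⟩
    rwa [G.info_avail i h.1 h.2 x hx y hy]
  unfold StdStrategy
  infer_instance

instance (i : I) : Finite (G.Strategy i) := by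
  unfold Strategy
  infer_instance

noncomputable instance (i : I) : Fintype (G.Strategy i) := Fintype.ofFinite _

/-- `S_{-i}`: the profiles of strategies of the players other than `i`. -/
def OppStrategy (i : I) : Type _ := ∀ j : {j // j ≠ i}, G.Strategy j

instance [Finite I] (i : I) : Finite (G.OppStrategy i) := by
  unfold OppStrategy
  infer_instance

noncomputable instance [Finite I] (i : I) : Fintype (G.OppStrategy i) := Fintype.ofFinite _

/-- `ζ(s_i, s_{-i})`. -/
noncomputable def play [DecidableEq I] (i : I) (si : G.Strategy i) (q : G.OppStrategy i) :
    G.Outcome :=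
  G.outcome ((Equiv.piSplitAt i G.Strategy).symm (si, q))

/-- `S(h)`: the strategy profiles that reach the information set `h`. -/
def reach (h : Set (List (∀ i, A i))) : Set (∀ i, G.Strategy i) :=
  {s | ∃ x ∈ h, x <+: (G.outcome s).1}

/-- `S_i(h)`, the projection of `S(h)` on `S_i`. -/
def reachOwn (i : I) (h : Set (List (∀ i, A i))) : Set (G.Strategy i) :=
  (fun s => s i) '' G.reach h

/-- `S_{-i}(h)`, the projection of `S(h)` on `S_{-i}`. -/
def reachOpp (i : I) (h : Set (List (∀ i, A i))) : Set (G.OppStrategy i) :=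
  (fun s => fun j : {j // j ≠ i} => s j) '' G.reach h

/-- `H_i(s_i)`: the information sets of player `i` allowed by her strategy `s_i`. -/
def allowed (i : I) (si : G.Strategy i) : Set (Set (List (∀ i, A i))) :=
  {h | h ∈ G.infoSets i ∧ si ∈ G.reachOwn i h}

/-- A family of sets of strategies, one for each player; the family `R` stands for the product
set of profiles `∏ j, R j`. -/
abbrev Family : Type _ := ∀ j, Set (G.Strategy j)

/-- The product set of strategy profiles that a family stands for. -/
def profiles (R : G.Family) : Set (∀ j, G.Strategy j) := Set.univ.pi R

/-- A restriction is a nonempty product set of strategy profiles. -/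
def IsRestriction (R : G.Family) : Prop := (G.profiles R).Nonempty

/-- The restriction `S` of all strategy profiles. -/
def full : G.Family := fun _ => Set.univ

/-- `R_i(h) = R_i ∩ S_i(h)`. -/
def ownAt (R : G.Family) (i : I) (h : Set (List (∀ i, A i))) : Set (G.Strategy i) :=
  R i ∩ G.reachOwn i h

/-- `R_{-i}(h) = R_{-i} ∩ S_{-i}(h)`. -/
def oppAt (R : G.Family) (i : I) (h : Set (List (∀ i, A i))) : Set (G.OppStrategy i) :=
  {q | ∀ j : {j // j ≠ i}, q j ∈ R j} ∩ G.reachOpp i h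

/-- `R^i(h) = R_i(h) × R_{-i}(h)`. -/
def condProblem (R : G.Family) (i : I) (h : Set (List (∀ i, A i))) :
    Set (G.Strategy i × G.OppStrategy i) :=
  G.ownAt R i h ×ˢ G.oppAt R i h

section Ordinal

variable [DecidableEq I]

/-- `t` weakly dominates `s` on the set `Q` of the opponents' profiles. -/
def WeaklyDominates (i : I) (Q : Set (G.OppStrategy i)) (t s : G.Strategy i) : Prop :=
  (∀ q ∈ Q, G.pref i (G.play i t q) (G.play i s q)) ∧
    ∃ q ∈ Q, G.StrictPref i (G.play i t q) (G.play i s q)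

/-- The strategies in `P` that are admissible with respect to `P × Q`. -/
def admissible (i : I) (P : Set (G.Strategy i)) (Q : Set (G.OppStrategy i)) :
    Set (G.Strategy i) :=
  {s | s ∈ P ∧ ¬ ∃ t ∈ P, G.WeaklyDominates i Q t s}

/-- The strategies in `P` that are B-dominated with respect to `P × Q`. -/
def bDominated (i : I) (P : Set (G.Strategy i)) (Q : Set (G.OppStrategy i)) :
    Set (G.Strategy i) :=
  {s | s ∈ P ∧ ∀ Q' ⊆ Q, Q'.Nonempty → s ∉ G.admissible i P Q'}

/-- The operator `𝕌`: the strategies that are not conditionally B-dominated with respect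
to `R`. -/
def opU (R : G.Family) : G.Family := fun i =>
  {s | s ∈ R i ∧ ∀ h ∈ G.allowed i s, (G.condProblem R i h).Nonempty →
    s ∉ G.bDominated i (G.ownAt R i h) (G.oppAt R i h)}

end Ordinal

/-- The Bernoulli utility functions that represent `≿_i`. -/
def utilities (i : I) : Set (G.Outcome → ℝ) := {u | ∀ z z', u z ≥ u z' ↔ G.pref i z z'}

section Cardinal

variable [DecidableEq I]

/-- The strategies in `P` that are strictly dominated relative to `P × Q` by a mixed strategy
supported in `P`, under the utility function `v` of player `i`. -/
def mixedDominated (i : I) (v : G.Outcome → ℝ) (P : Set (G.Strategy i))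
    (Q : Set (G.OppStrategy i)) : Set (G.Strategy i) :=
  {s | s ∈ P ∧ ∃ σ ∈ stdSimplex ℝ (G.Strategy i), (∀ t, t ∉ P → σ t = 0) ∧
    ∀ q ∈ Q, ∑ t, σ t * v (G.play i t q) > v (G.play i s q)}

/-- `𝕄_i(R)[v]`: the strategies in `R_i` that are not conditionally dominated by a mixed strategy,
under the utility function `v` of player `i`. -/
def opM (i : I) (v : G.Outcome → ℝ) (R : G.Family) : Set (G.Strategy i) :=
  {s | s ∈ R i ∧ ∀ h ∈ G.allowed i s, (G.condProblem R i h).Nonempty →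
    s ∉ G.mixedDominated i v (G.ownAt R i h) (G.oppAt R i h)}

/-- The conditioning events `S_{-i}(h)`, for `h ∈ H_i`. -/
def condEvents (i : I) : Set (Set (G.OppStrategy i)) := G.reachOpp i '' G.infoSets i

/-- The conditioning event of an information set. -/
def eventAt (i : I) (h : G.infoSets i) : G.condEvents i :=
  ⟨G.reachOpp i h.1, h.1, h.2, rfl⟩

open Classical in
/-- The probability of the set `E` under the weights `w`. -/
noncomputable def prob [Finite I] {i : I} (w : G.OppStrategy i → ℝ) (E : Set (G.OppStrategy i)) :
    ℝ :=
  ∑ q, if q ∈ E then w q else 0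

/-- `μ` is a conditional probability system on `S_{-i}` for the conditioning events of `i`;
`μ C q` is the probability of `{q}` given `C`. -/
structure IsCPS [Finite I] (i : I) (μ : G.condEvents i → G.OppStrategy i → ℝ) : Prop where
  mem_simplex : ∀ C, μ C ∈ stdSimplex ℝ (G.OppStrategy i)
  prob_self : ∀ C, G.prob (μ C) C.1 = 1
  chain_rule : ∀ (C D : G.condEvents i) (E : Set (G.OppStrategy i)), E ⊆ D.1 → D.1 ⊆ C.1 →
    G.prob (μ C) E = G.prob (μ D) E * G.prob (μ C) D.1

/-- The conditional probability systems that assign probability one to `R_{-i}(h)` at every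
`h ∈ H_i` whose restricted conditional problem is nonempty. -/
def cpsOn [Finite I] (i : I) (R : G.Family) : Set (G.condEvents i → G.OppStrategy i → ℝ) :=
  {μ | G.IsCPS i μ ∧ ∀ h : G.infoSets i, (G.condProblem R i h.1).Nonempty →
    G.prob (μ (G.eventAt i h)) (G.oppAt R i h.1) = 1}

/-- The expected utility at `h` of the strategy `s` under the beliefs `μ`. -/
noncomputable def condUtility [Finite I] (i : I) (v : G.Outcome → ℝ)
    (μ : G.condEvents i → G.OppStrategy i → ℝ) (h : G.infoSets i) (s : G.Strategy i) : ℝ :=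
  ∑ q, v (G.play i s q) * μ (G.eventAt i h) q

/-- The operator `𝐑` of Strong Rationalizability under the profile `u` of utility functions: the
strategies in `R_i` that, for some beliefs in `cpsOn i R`, maximize expected utility at every
information set `h` that they allow and that has a nonempty restricted conditional problem,
among the strategies of `i` that reach `h`. -/
def opR [Finite I] (u : I → G.Outcome → ℝ) (R : G.Family) : G.Family := fun i =>
  {s | s ∈ R i ∧ ∃ μ ∈ G.cpsOn i R, ∀ h : G.infoSets i, h.1 ∈ G.allowed i s →
    (G.condProblem R i h.1).Nonempty →
      ∀ t ∈ G.reachOwn i h.1, G.condUtility i (u i) μ h t ≤ G.condUtility i (u i) μ h s}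

/-- `𝕌^k(S)`, the `k`-th round of Iterative Conditional B-Dominance. -/
def icbd (k : ℕ) : G.Family := G.opU^[k] G.full

/-- `𝕌^∞(S)`: the strategy profiles that survive every round. -/
def icbdLimit : Set (∀ j, G.Strategy j) := ⋂ k, G.profiles (G.icbd k)

/-- `𝕌^∞_i(S)`: the strategies of player `i` that survive every round. -/
def icbdLimitOf (i : I) : Set (G.Strategy i) := ⋂ k, G.icbd k i

/-- `𝐑^k(S)[u]`, the `k`-th round of Strong Rationalizability. -/
def strongRat [Finite I] (u : I → G.Outcome → ℝ) (k : ℕ) : G.Family := (G.opR u)^[k] G.full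

/-- `𝐑^∞(S)[u]`: the strategy profiles that survive every round under `u`. -/
def strongRatLimit [Finite I] (u : I → G.Outcome → ℝ) : Set (∀ j, G.Strategy j) :=
  ⋂ k, G.profiles (G.strongRat u k)

/-- `𝐑^∞_i(S)[u]`: the strategies of player `i` that survive every round under `u`. -/
def strongRatLimitOf [Finite I] (u : I → G.Outcome → ℝ) (i : I) : Set (G.Strategy i) :=
  ⋂ k, G.strongRat u k i

end Cardinal

end DynamicGame

/-! One utility per player, `steepUtility`, serves every round: it is so concave in the rank of
outcomes that losing one rank outweighs all gains elsewhere. If `s` is admissible on P × Q',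
suitable positive weights on Q' make it a best reply in P (`exists_weights_of_admissible`).
Conversely, under any representing utility, a best reply to nonzero weights is admissible on their
support. Together with the passage from B-domination to strict domination by a mixture
(`exists_mixture_gt`), this settles the identity between 𝕌 and the union of the 𝕄.

For the iterated statements it suffices that 𝕌 and 𝐑 agree on every `icbd k`. The inclusion of 𝐑 in
𝕌 is immediate. The other one meets two obstacles: the weights found separately at each information
set must fit into one CPS, and 𝐑 compares `s` with all strategies reaching h, not only with the
survivors.

For the first, go through the information sets from earlier to later and keep the weights at a set
only if no weights kept before charge its event. The kept weights form a sequence that defines a CPS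
(`exists_isCPS_of_sequence`), and optimality passes to later sets by perfect recall
(`expUtility_indicator_le_of_best`). For the second, `exists_best_mem_icbd` shows that where weights
are kept, some best reply among all strategies itself survives k rounds, so beating the survivors is
enough. -/

namespace DynamicGame

variable {I : Type*} {A : I → Type*} (G : DynamicGame I A)

/-! ### Paths of play, reachability and perfect recall. -/

/-- Every action of player `i` along `x` is the one prescribed by `r`. -/
def FollowsOwn (i : I) (r : G.StdStrategy i) (x : List (∀ i, A i)) : Prop :=
  ∀ (y : List (∀ i, A i)) (a : ∀ i, A i), y ++ [a] <+: x →
    ∀ h : G.infoSets i, y ∈ h.1 → (r h : A i) = a i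

/-- Every action of the opponents of `i` along `x` is the one prescribed by representatives
of `q`. -/
def FollowsOpp (i : I) (q : G.OppStrategy i) (x : List (∀ i, A i)) : Prop :=
  ∀ (y : List (∀ i, A i)) (a : ∀ i, A i), y ++ [a] <+: x →
    ∀ (j : {j // j ≠ i}) (h : G.infoSets j), y ∈ h.1 → (Quotient.out (q j) h : A j) = a j

theorem isPrefix_stdOutcome {s : ∀ i, G.StdStrategy i} {x : List (∀ i, A i)}
    (hx : x ∈ G.hist) (hs : G.Follows s x) : x <+: (G.stdOutcome s).1 := by
  have hz' : G.Follows s (G.stdOutcome s).1 := (G.stdOutcome_eq_iff s _).mp rfl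
  induction x using List.reverseRecOn with
  | nil => exact List.nil_prefix
  | append_singleton x a ih =>
    have hxh := G.mem_of_snoc x a hx
    obtain ⟨t, ht⟩ := ih hxh fun y b hy => hs y b (hy.trans (List.prefix_append x [a]))
    cases t with
    | nil =>
      have hzx : (G.stdOutcome s).1 = x := by simpa using ht.symm
      exact absurd hx (hzx ▸ (G.stdOutcome s).2.2 a)
    | cons a' t =>
      have hpre : x ++ [a'] <+: (G.stdOutcome s).1 := ⟨t, by simpa using ht⟩
      have hmem' : x ++ [a'] ∈ G.hist := G.mem_of_isPrefix_mem hpre (G.stdOutcome s).2.1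
      have : a = a' := by
        funext i
        by_cases hi : G.toGameTree.Active i x
        · obtain ⟨h, ⟨hh, hxh⟩, -⟩ := G.info_partition i x hi
          rw [← hs x a List.prefix_rfl i ⟨h, hh⟩ hxh, ← hz' x a' hpre i ⟨h, hh⟩ hxh]
        · have hs : (G.avail x i).Subsingleton :=
            Set.not_nontrivial_iff.mp fun hn => hi ⟨hxh, hn⟩
          exact hs ⟨a, hx, rfl⟩ ⟨a', hmem', rfl⟩
      rwa [this]

section

variable {G}

theorem infoSet_mem_hist {i : I} {h : Set (List (∀ i, A i))} (hh : h ∈ G.infoSets i)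
    {x : List (∀ i, A i)} (hx : x ∈ h) : x ∈ G.hist := (G.info_active i h hh x hx).1

theorem infoSet_eq {i : I} {g h : Set (List (∀ i, A i))} (hg : g ∈ G.infoSets i)
    (hh : h ∈ G.infoSets i) {x : List (∀ i, A i)} (hxg : x ∈ g) (hxh : x ∈ h) : g = h := by
  obtain ⟨k, -, hk⟩ := G.info_partition i x (G.info_active i h hh x hxh)
  rw [hk g ⟨hg, hxg⟩, hk h ⟨hh, hxh⟩]

theorem exists_snoc_isPrefix {x y : List (∀ i, A i)} (hxy : x <+: y) (hne : x ≠ y) :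
    ∃ a, x ++ [a] <+: y := by
  obtain ⟨t, rfl⟩ := hxy
  cases t with
  | nil => simp at hne
  | cons a t => exact ⟨a, t, by simp⟩

/-- Infinite descent on length: perfect recall of `g` with respect to itself would put a strictly
shorter member of `g` below every member. -/
theorem not_snoc_isPrefix_same {i : I} {g : Set (List (∀ i, A i))} (hg : g ∈ G.infoSets i)
    {x y : List (∀ i, A i)} (hx : x ∈ g) (hy : y ∈ g) (a : ∀ i, A i) :
    ¬ y ++ [a] <+: x := by
  intro hyx
  have key : ∀ n, ∀ x' ∈ g, x'.length = n → False := by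
    intro n
    induction n using Nat.strong_induction_on with
    | _ n ih =>
      intro x' hx' hn
      obtain ⟨y', hy', a', hya', -⟩ := G.perfect_recall i g hg g hg x hx x' hx' y hy a hyx
      have := hya'.length_le
      simp only [List.length_append, List.length_singleton] at this
      exact ih y'.length (by omega) y' hy' rfl
  exact key _ x hx rfl

theorem eq_of_isPrefix_same {i : I} {g : Set (List (∀ i, A i))} (hg : g ∈ G.infoSets i)
    {x y z : List (∀ i, A i)} (hx : x ∈ g) (hy : y ∈ g) (hxz : x <+: z) (hyz : y <+: z) :
    x = y := by
  by_contra hne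
  rcases List.prefix_or_prefix_of_prefix hxz hyz with h | h
  · obtain ⟨a, ha⟩ := exists_snoc_isPrefix h hne
    exact not_snoc_isPrefix_same hg hy hx a ha
  · obtain ⟨a, ha⟩ := exists_snoc_isPrefix h (Ne.symm hne)
    exact not_snoc_isPrefix_same hg hx hy a ha

/-- Copying the moves along `x` is consistent because a path meets each information set at most
once. -/
theorem exists_follows_of_mem_hist {x : List (∀ i, A i)} (hx : x ∈ G.hist) :
    ∃ s : ∀ i, G.StdStrategy i, G.Follows s x := by
  classical
  have key : ∀ (i : I) (h : G.infoSets i), ∃ b : G.availAt i h.1,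
      ∀ y a, y ++ [a] <+: x → y ∈ h.1 → (b : A i) = a i := by
    intro i h
    by_cases hex : ∃ y a, y ++ [a] <+: x ∧ y ∈ h.1
    · obtain ⟨y, a, hya, hy⟩ := hex
      refine ⟨⟨a i, y, hy, a, G.mem_of_isPrefix_mem hya hx, rfl⟩, fun y' a' hya' hy' => ?_⟩
      have e : y = y' := eq_of_isPrefix_same h.2 hy hy'
        ((List.prefix_append _ _).trans hya) ((List.prefix_append _ _).trans hya')
      subst e
      have := List.prefix_of_prefix_length_le hya hya' (by simp)
      have := this.eq_of_length (by simp)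
      simp only [List.append_cancel_left_eq, List.cons.injEq, and_true] at this
      exact congrFun this i
    · obtain ⟨y, hy⟩ := G.info_nonempty i h.1 h.2
      obtain ⟨b, hb⟩ := (G.info_active i h.1 h.2 y hy).2.nonempty
      exact ⟨⟨b, y, hy, hb⟩, fun y a hya hy => absurd ⟨y, a, hya, hy⟩ hex⟩
  choose s hs using key
  exact ⟨s, fun y a hya i h hy => hs i h y a hya hy⟩

theorem reach_nonempty {i : I} {h : Set (List (∀ i, A i))} (hh : h ∈ G.infoSets i) :
    (G.reach h).Nonempty := by
  obtain ⟨x, hx⟩ := G.info_nonempty i h hh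
  obtain ⟨s, hs⟩ := exists_follows_of_mem_hist (infoSet_mem_hist hh hx)
  refine ⟨fun i => Quotient.mk _ (s i), x, hx, ?_⟩
  rw [outcome_mk]
  exact G.isPrefix_stdOutcome (infoSet_mem_hist hh hx) hs

theorem reachOpp_nonempty {i : I} {h : Set (List (∀ i, A i))} (hh : h ∈ G.infoSets i) :
    (G.reachOpp i h).Nonempty := (reach_nonempty hh).image _

theorem followsOwn_of_mem {i : I} {h : Set (List (∀ i, A i))} (hh : h ∈ G.infoSets i)
    {r : G.StdStrategy i} {x x' : List (∀ i, A i)} (hx : x ∈ h) (hx' : x' ∈ h)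
    (hr : G.FollowsOwn i r x) : G.FollowsOwn i r x' := by
  intro y a hya g hy
  obtain ⟨y', hy', a', hya', e⟩ :=
    G.perfect_recall i g.1 g.2 h hh x' hx' x hx y hy a hya
  rw [← e]
  exact hr y' a' hya' g hy'

theorem reach_subset_of_isPrefix {i : I} {g h : Set (List (∀ i, A i))}
    (hg : g ∈ G.infoSets i) (hh : h ∈ G.infoSets i) {x y : List (∀ i, A i)}
    (hy : y ∈ g) (hx : x ∈ h) (hyx : y <+: x) : G.reach h ⊆ G.reach g := by
  by_cases e : y = x
  · subst e
    rw [infoSet_eq hg hh hy hx]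
  · obtain ⟨a, ha⟩ := exists_snoc_isPrefix hyx e
    rintro s ⟨x', hx', hs⟩
    obtain ⟨y', hy', a', hya', -⟩ := G.perfect_recall i g hg h hh x hx x' hx' y hy a ha
    exact ⟨y', hy', ((List.prefix_append _ _).trans hya').trans hs⟩

/-- Information sets of the same player reached by a common profile are ordered. -/
theorem reach_subset_or_subset {i : I} {g h : Set (List (∀ i, A i))}
    (hg : g ∈ G.infoSets i) (hh : h ∈ G.infoSets i) {s : ∀ i, G.Strategy i}
    (hsg : s ∈ G.reach g) (hsh : s ∈ G.reach h) :
    G.reach h ⊆ G.reach g ∨ G.reach g ⊆ G.reach h := by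
  obtain ⟨y, hy, hys⟩ := hsg
  obtain ⟨x, hx, hxs⟩ := hsh
  rcases List.prefix_or_prefix_of_prefix hys hxs with h' | h'
  · exact Or.inl (reach_subset_of_isPrefix hg hh hy hx h')
  · exact Or.inr (reach_subset_of_isPrefix hh hg hx hy h')

theorem reachOwn_mono {i : I} {g h : Set (List (∀ i, A i))} (hgh : G.reach h ⊆ G.reach g) :
    G.reachOwn i h ⊆ G.reachOwn i g := Set.image_mono hgh

theorem reachOpp_mono {i : I} {g h : Set (List (∀ i, A i))} (hgh : G.reach h ⊆ G.reach g) :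
    G.reachOpp i h ⊆ G.reachOpp i g := Set.image_mono hgh

end

section Play

variable [DecidableEq I]

/-- Reaching a history splits into a condition on `r` alone and one on `q` alone; this lets own
strategies and opponents' profiles be recombined. -/
theorem isPrefix_play_iff (i : I) (r : G.StdStrategy i) (q : G.OppStrategy i)
    (x : List (∀ i, A i)) :
    x <+: (G.play i (Quotient.mk (G.behavioralSetoid i) r) q).1 ↔
      x ∈ G.hist ∧ G.FollowsOwn i r x ∧ G.FollowsOpp i q x := by
  set s : ∀ j, G.StdStrategy j := fun j =>
    if e : j = i then e ▸ r else Quotient.out (q ⟨j, e⟩) with hs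
  have hsi : s i = r := by simp [hs]
  have hsj : ∀ j : {j // j ≠ i}, s j = Quotient.out (q j) := fun j => by simp [hs, j.2]
  have hplay : G.play i (Quotient.mk (G.behavioralSetoid i) r) q = G.stdOutcome s := by
    rw [← outcome_mk]
    unfold play
    congr 1
    funext j
    by_cases e : j = i
    · subst e
      rw [hsi]
      simp only [Equiv.piSplitAt, Equiv.coe_fn_symm_mk]
      exact dif_pos rfl
    · have h1 := hsj ⟨j, e⟩
      simp only at h1
      rw [h1]
      simp only [Equiv.piSplitAt, Equiv.coe_fn_symm_mk, e, dite_false]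
      exact (Quotient.out_eq _).symm
  rw [hplay]
  constructor
  · intro hx
    have hf : G.Follows s (G.stdOutcome s).1 := (G.stdOutcome_eq_iff s _).mp rfl
    refine ⟨G.mem_of_isPrefix_mem hx (G.stdOutcome s).2.1, ?_, ?_⟩
    · intro y a hya h hy
      rw [← hsi]
      exact hf y a (hya.trans hx) i h hy
    · intro y a hya j h hy
      rw [← hsj]
      exact hf y a (hya.trans hx) j h hy
  · rintro ⟨hx, h1, h2⟩
    refine G.isPrefix_stdOutcome hx fun y a hya j h hy => ?_
    by_cases e : j = i
    · subst e
      rw [hsi]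
      exact h1 y a hya h hy
    · have h3 := hsj ⟨j, e⟩
      simp only at h3
      rw [h3]
      exact h2 y a hya ⟨j, e⟩ h hy

theorem play_eq_iff (i : I) (r : G.StdStrategy i) (q : G.OppStrategy i) (z : G.Outcome) :
    G.play i (Quotient.mk (G.behavioralSetoid i) r) q = z ↔
      G.FollowsOwn i r z.1 ∧ G.FollowsOpp i q z.1 := by
  constructor
  · rintro rfl
    exact ((G.isPrefix_play_iff i r q _).mp List.prefix_rfl).2
  · intro h
    have hp := (G.isPrefix_play_iff i r q z.1).mpr ⟨z.2.1, h⟩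
    by_contra hne
    obtain ⟨a, ha⟩ := exists_snoc_isPrefix hp fun e => hne (Subtype.ext e.symm)
    exact z.2.2 a (G.mem_of_isPrefix_mem ha (G.play i _ q).2.1)

/-- The profile of strategies `(t, q)`. -/
abbrev join (i : I) (t : G.Strategy i) (q : G.OppStrategy i) : ∀ j, G.Strategy j :=
  (Equiv.piSplitAt i G.Strategy).symm (t, q)

theorem join_self (i : I) (t : G.Strategy i) (q : G.OppStrategy i) : G.join i t q i = t := by
  simp [join, Equiv.piSplitAt]

theorem join_opp (i : I) (t : G.Strategy i) (q : G.OppStrategy i) :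
    (fun j : {j // j ≠ i} => G.join i t q j) = q := by
  funext j
  simp [join, Equiv.piSplitAt, j.2]

theorem join_eta (i : I) (s : ∀ j, G.Strategy j) :
    G.join i (s i) (fun j : {j // j ≠ i} => s j) = s :=
  (Equiv.piSplitAt i G.Strategy).symm_apply_apply s

variable {G}

theorem mem_reachOwn_iff {i : I} {h : Set (List (∀ i, A i))} {t : G.Strategy i} :
    t ∈ G.reachOwn i h ↔ ∃ q, G.join i t q ∈ G.reach h := by
  constructor
  · rintro ⟨s, hs, rfl⟩
    exact ⟨fun j => s j, by rwa [join_eta]⟩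
  · rintro ⟨q, hq⟩
    exact ⟨_, hq, G.join_self i t q⟩

theorem mem_reachOpp_iff {i : I} {h : Set (List (∀ i, A i))} {q : G.OppStrategy i} :
    q ∈ G.reachOpp i h ↔ ∃ t, G.join i t q ∈ G.reach h := by
  constructor
  · rintro ⟨s, hs, rfl⟩
    exact ⟨s i, by rwa [join_eta]⟩
  · rintro ⟨t, hq⟩
    exact ⟨_, hq, G.join_opp i t q⟩

/-- By perfect recall, `S(h)` is the product of its projections. -/
theorem join_mem_reach_iff {i : I} {h : Set (List (∀ i, A i))} (hh : h ∈ G.infoSets i)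
    {t : G.Strategy i} {q : G.OppStrategy i} :
    G.join i t q ∈ G.reach h ↔ t ∈ G.reachOwn i h ∧ q ∈ G.reachOpp i h := by
  refine ⟨fun hr => ⟨mem_reachOwn_iff.mpr ⟨q, hr⟩, mem_reachOpp_iff.mpr ⟨t, hr⟩⟩, ?_⟩
  rintro ⟨ht, hq⟩
  obtain ⟨q', x, hx, hxt⟩ := mem_reachOwn_iff.mp ht
  obtain ⟨t', x', hx', hxq⟩ := mem_reachOpp_iff.mp hq
  obtain ⟨r, rfl⟩ := Quotient.exists_rep t
  obtain ⟨r', rfl⟩ := Quotient.exists_rep t'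
  have h1 := (G.isPrefix_play_iff i r q' x).mp hxt
  have h2 := (G.isPrefix_play_iff i r' q x').mp hxq
  exact ⟨x', hx', (G.isPrefix_play_iff i r q x').mpr
    ⟨h2.1, followsOwn_of_mem hh hx hx' h1.2.1, h2.2.2⟩⟩

/-- A strategy that reaches `h` can be replaced from `h` on by another strategy that
reaches `h`. -/
theorem exists_replacement {i : I} {h : Set (List (∀ i, A i))} (hh : h ∈ G.infoSets i)
    {s t : G.Strategy i} (hs : s ∈ G.reachOwn i h) (ht : t ∈ G.reachOwn i h) :
    ∃ r : G.Strategy i, (∀ q ∈ G.reachOpp i h, G.play i r q = G.play i t q) ∧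
      ∀ q ∉ G.reachOpp i h, G.play i r q = G.play i s q := by
  classical
  obtain ⟨s', rfl⟩ := Quotient.exists_rep s
  obtain ⟨t', rfl⟩ := Quotient.exists_rep t
  -- The switch to `t'` must depend on the information set, not on the history; perfect recall makes
  -- one witness in `g` decisive.
  let after : Set (List (∀ i, A i)) → Prop := fun g => ∃ x ∈ g, ∃ y ∈ h, y <+: x
  let r : G.StdStrategy i := fun g => if after g.1 then t' g else s' g
  refine ⟨Quotient.mk _ r, fun q hq => ?_, fun q hq => ?_⟩
  · obtain ⟨y, hy, hyz⟩ := (join_mem_reach_iff hh).mpr ⟨ht, hq⟩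
    obtain ⟨q', y', hy', hyz'⟩ := mem_reachOwn_iff.mp hs
    have h1 := ((G.isPrefix_play_iff i s' q' y').mp hyz').2.1
    have h2 := followsOwn_of_mem hh hy' hy h1
    have h3 := (G.play_eq_iff i t' q _).mp rfl
    refine (G.play_eq_iff i r q _).mpr ⟨fun x a hxa g hx => ?_, h3.2⟩
    by_cases hg : after g.1
    · simp only [r, hg, if_true]
      exact h3.1 x a hxa g hx
    · simp only [r, hg, if_false]
      have hyx : ¬ y <+: x := fun e => hg ⟨x, hx, y, hy, e⟩
      refine h2 x a ?_ g hx
      rcases List.prefix_or_prefix_of_prefix hxa hyz with h4 | h4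
      · exact h4
      · rcases List.prefix_concat_iff.mp h4 with h5 | h5
        · rw [h5]
        · exact absurd h5 hyx
  · have h3 := (G.play_eq_iff i s' q _).mp rfl
    refine (G.play_eq_iff i r q _).mpr ⟨fun x a hxa g hx => ?_, h3.2⟩
    -- If `g` came after `h`, every profile reaching `g` would reach `h`, including this one.
    have hg : ¬ after g.1 := by
      rintro ⟨x', hx', y, hy, hyx⟩
      have hxz : x <+: (G.play i (Quotient.mk _ s') q).1 := (List.prefix_append _ _).trans hxa
      have : G.join i (Quotient.mk _ s') q ∈ G.reach h :=
        reach_subset_of_isPrefix hh g.2 hy hx' hyx ⟨x, hx, hxz⟩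
      exact hq (mem_reachOpp_iff.mpr ⟨_, this⟩)
    simp only [r, hg, if_false]
    exact h3.1 x a hxa g hx

/-- A strategy whose outcomes agree with those of `t` on `S_{-i}(h)` reaches `h` if `t` does. -/
theorem mem_reachOwn_of_play_eq {i : I} {h : Set (List (∀ i, A i))} (hh : h ∈ G.infoSets i)
    {r t : G.Strategy i} (ht : t ∈ G.reachOwn i h)
    (hr : ∀ q ∈ G.reachOpp i h, G.play i r q = G.play i t q) : r ∈ G.reachOwn i h := by
  obtain ⟨q, hq⟩ := reachOpp_nonempty hh
  obtain ⟨x, hx, hxz⟩ := (join_mem_reach_iff hh).mpr ⟨ht, hq⟩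
  refine mem_reachOwn_iff.mpr ⟨q, x, hx, ?_⟩
  change x <+: (G.play i r q).1
  rw [hr q hq]
  exact hxz

end Play

end DynamicGame

/-! ### From weak domination on every subset to strict mixed domination. -/

/-- A weak dominator on `Q` gains strictly somewhere; on the smaller set where it only ties,
induction gives a strictly dominating mixture. A small share of that mixture breaks the ties without
destroying the strict gains. -/
theorem exists_mixture_gt {α β : Type*} [Fintype α] (P : Set α) (f : α → β → ℝ) (s : α)
    (Q : Finset β) (hQ : Q.Nonempty)
    (H : ∀ Q' ⊆ Q, Q'.Nonempty →
      ∃ t ∈ P, (∀ q ∈ Q', f s q ≤ f t q) ∧ ∃ q ∈ Q', f s q < f t q) :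
    ∃ σ ∈ stdSimplex ℝ α, (∀ t, t ∉ P → σ t = 0) ∧ ∀ q ∈ Q, f s q < ∑ t, σ t * f t q := by
  classical
  induction Q using Finset.strongInduction with
  | H Q ih =>
    obtain ⟨t, htP, hle, q₀, hq₀, hlt⟩ := H Q subset_rfl hQ
    by_cases hQ' : (Q.filter fun q => f t q ≤ f s q).Nonempty
    · have hss : Q.filter (fun q => f t q ≤ f s q) ⊂ Q :=
        Finset.filter_ssubset.mpr ⟨q₀, hq₀, not_le.mpr hlt⟩
      obtain ⟨σ, hσ, hσP, hσlt⟩ := ih _ hss hQ' fun Q' h => H Q' (h.trans hss.1)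
      have hev : ∀ q ∈ Q, ∀ᶠ ε in nhdsWithin (0 : ℝ) (Set.Ioi 0),
          f s q < (1 - ε) * f t q + ε * ∑ a, σ a * f a q := by
        intro q hq
        by_cases hqs : f t q ≤ f s q
        · have e : f t q = f s q := le_antisymm hqs (hle q hq)
          have h1 := hσlt q (Finset.mem_filter.mpr ⟨hq, hqs⟩)
          filter_upwards [self_mem_nhdsWithin] with ε hε
          have hε' : (0 : ℝ) < ε := hε
          rw [e]
          nlinarith
        · have hc : Filter.Tendsto (fun ε : ℝ => (1 - ε) * f t q + ε * ∑ a, σ a * f a q)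
              (nhdsWithin (0 : ℝ) (Set.Ioi 0)) (nhds (f t q)) := by
            have : Continuous fun ε : ℝ => (1 - ε) * f t q + ε * ∑ a, σ a * f a q := by
              fun_prop
            have h0 := this.tendsto 0
            simp only [sub_zero, one_mul, zero_mul, add_zero] at h0
            exact h0.mono_left nhdsWithin_le_nhds
          exact hc.eventually (lt_mem_nhds (not_le.mp hqs))
      have hall := (Filter.eventually_all_finset Q).mpr hev
      have h01 : ∀ᶠ ε in nhdsWithin (0 : ℝ) (Set.Ioi 0), ε ∈ Set.Ioo (0 : ℝ) 1 :=
        Ioo_mem_nhdsGT one_pos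
      obtain ⟨ε, hε, hε0, hε1⟩ := (hall.and h01).exists
      refine ⟨(1 - ε) • Pi.single t 1 + ε • σ,
        convex_stdSimplex ℝ α (single_mem_stdSimplex ℝ t) hσ (by linarith) hε0.le (by ring),
        fun a ha => ?_, fun q hq => ?_⟩
      · have : a ≠ t := fun e => ha (e ▸ htP)
        simp [this, hσP a ha]
      · refine (hε q hq).trans_eq ?_
        simp only [Pi.add_apply, Pi.smul_apply, smul_eq_mul, add_mul, Finset.sum_add_distrib,
          Finset.mul_sum, mul_assoc, Pi.single_apply, ite_mul, one_mul, zero_mul, mul_ite,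
          mul_zero, Finset.sum_ite_eq', Finset.mem_univ, if_true]
    · refine ⟨Pi.single t 1, single_mem_stdSimplex ℝ t, fun a ha => ?_, fun q hq => ?_⟩
      · have : a ≠ t := fun e => ha (e ▸ htP)
        simp [this]
      · have : f s q < f t q := by
          by_contra hn
          exact hQ' ⟨q, Finset.mem_filter.mpr ⟨hq, not_lt.mp hn⟩⟩
        simpa [Pi.single_apply] using this

/-! ### Ordinal ranks, the steep utility and the characterization of one round. -/

namespace DynamicGame

variable {I : Type*} {A : I → Type*} (G : DynamicGame I A)

instance : Finite G.Outcome := G.hist_finite.subset fun _ hz => hz.1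

theorem pref_refl (i : I) (z : G.Outcome) : G.pref i z z := or_self_iff.mp (G.pref_total i z z)

/-- The number of outcomes that player `i` finds no better than `z`. -/
noncomputable def rank (i : I) (z : G.Outcome) : ℕ := {z' | G.pref i z z'}.ncard

theorem rank_le_rank_iff (i : I) (z z' : G.Outcome) :
    G.rank i z' ≤ G.rank i z ↔ G.pref i z z' := by
  constructor
  · intro h
    by_contra hn
    have hz' : G.pref i z' z := (G.pref_total i z' z).resolve_right hn
    refine absurd h (not_le.mpr (Set.ncard_lt_ncard ?_ (Set.toFinite _)))
    refine ⟨fun w hw => G.pref_trans i _ _ _ hz' hw, fun hss => hn ?_⟩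
    exact hss (show z' ∈ {w | G.pref i z' w} from G.pref_refl i z')
  · intro h
    exact Set.ncard_le_ncard (fun w hw => G.pref_trans i _ _ _ h hw) (Set.toFinite _)

variable {G} in
theorem exists_admissible_of_not_bDominated [DecidableEq I] {i : I} {P : Set (G.Strategy i)}
    {Q : Set (G.OppStrategy i)} {s : G.Strategy i} (hP : s ∈ P) (hs : s ∉ G.bDominated i P Q) :
    ∃ Q' ⊆ Q, Q'.Nonempty ∧ s ∈ G.admissible i P Q' := by
  by_contra! hn
  exact hs ⟨hP, fun Q' hQ' hne => hn Q' hQ' hne⟩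

variable {G} in
theorem utility_lt_iff {i : I} {v : G.Outcome → ℝ} (hv : v ∈ G.utilities i) (z z' : G.Outcome) :
    v z' < v z ↔ G.StrictPref i z z' := by
  have h1 := hv z z'
  have h2 := hv z' z
  rw [StrictPref, ← h1, ← h2, ge_iff_le, ge_iff_le, not_le]
  exact ⟨fun h => ⟨h.le, h⟩, fun h => h.2⟩

section

variable [Finite I]

/-- The base of the utility function `steepUtility`. -/
noncomputable def steepBase (i : I) : ℝ := (Fintype.card (G.OppStrategy i) : ℝ) + 2

theorem one_lt_steepBase (i : I) : 1 < G.steepBase i := by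
  unfold steepBase
  have : (0 : ℝ) ≤ Fintype.card (G.OppStrategy i) := Nat.cast_nonneg _
  linarith

/-- A utility function so concave in the rank of outcomes that a loss of one rank outweighs all
possible gains. -/
noncomputable def steepUtility (i : I) (z : G.Outcome) : ℝ := -(G.steepBase i ^ G.rank i z)⁻¹

theorem steepUtility_mem (i : I) : G.steepUtility i ∈ G.utilities i := by
  intro z z'
  have h1 := G.one_lt_steepBase i
  have h0 : 0 < G.steepBase i := by linarith
  rw [← G.rank_le_rank_iff, ge_iff_le, steepUtility, steepUtility, neg_le_neg_iff,
    inv_le_inv₀ (pow_pos h0 _) (pow_pos h0 _), pow_le_pow_iff_right₀ h1]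

end

section

variable [Finite I] [DecidableEq I]

/-- The expected utility of `t` under the (not necessarily normalized) weights `w`. -/
noncomputable def expUtility (i : I) (v : G.Outcome → ℝ) (w : G.OppStrategy i → ℝ)
    (t : G.Strategy i) : ℝ := ∑ q, w q * v (G.play i t q)

variable {G}

theorem exists_weights_of_admissible {i : I} {P : Set (G.Strategy i)}
    {Q : Set (G.OppStrategy i)} {s : G.Strategy i} (hs : s ∈ G.admissible i P Q) :
    ∃ w : G.OppStrategy i → ℝ, (∀ q ∈ Q, 0 < w q) ∧ (∀ q ∉ Q, w q = 0) ∧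
      ∀ t ∈ P, G.expUtility i (G.steepUtility i) w t ≤ G.expUtility i (G.steepUtility i) w s := by
  classical
  set N := G.steepBase i with hN
  have h1 : 1 < N := G.one_lt_steepBase i
  have h0 : 0 < N := by linarith
  -- These weights normalize the weighted utility of `s` to -1 at every profile in `Q`; that of `t`
  -- becomes minus `N` to the difference of the ranks of `s` and `t`.
  refine ⟨fun q => if q ∈ Q then N ^ G.rank i (G.play i s q) else 0,
    fun q hq => by simp only [hq, if_true]; positivity, fun q hq => by simp [hq], fun t ht => ?_⟩
  rw [← sub_nonneg, expUtility, expUtility, ← Finset.sum_sub_distrib]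
  set d : G.OppStrategy i → ℝ := fun q =>
    (if q ∈ Q then N ^ G.rank i (G.play i s q) else 0) * G.steepUtility i (G.play i s q) -
    (if q ∈ Q then N ^ G.rank i (G.play i s q) else 0) * G.steepUtility i (G.play i t q) with hd
  have hdQ : ∀ q ∈ Q, d q =
      N ^ G.rank i (G.play i s q) * (N ^ G.rank i (G.play i t q))⁻¹ - 1 := by
    intro q hq
    have : N ^ G.rank i (G.play i s q) ≠ 0 := (pow_pos h0 _).ne'
    simp only [hd, hq, if_true, steepUtility, ← hN]
    field_simp
    ring
  have hdge : ∀ q, -1 ≤ d q := by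
    intro q
    by_cases hq : q ∈ Q
    · rw [hdQ q hq]
      have : 0 ≤ N ^ G.rank i (G.play i s q) * (N ^ G.rank i (G.play i t q))⁻¹ := by positivity
      linarith
    · simp [hd, hq]
  by_cases hdom : ∀ q ∈ Q, G.pref i (G.play i t q) (G.play i s q)
  · refine Finset.sum_nonneg fun q _ => ?_
    by_cases hq : q ∈ Q
    · have h2 : G.pref i (G.play i s q) (G.play i t q) := by
        by_contra hn
        exact hs.2 ⟨t, ht, hdom, q, hq, hdom q hq, hn⟩
      have h3 := (G.rank_le_rank_iff i _ _).mpr h2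
      change 0 ≤ d q
      rw [hdQ q hq, sub_nonneg, ← div_eq_mul_inv, one_le_div (pow_pos h0 _)]
      exact pow_le_pow_right₀ h1.le h3
    · simp [hq]
  · push Not at hdom
    obtain ⟨q, hq, hn⟩ := hdom
    rw [← G.rank_le_rank_iff, not_le] at hn
    have h4 : N - 1 ≤ d q := by
      rw [hdQ q hq, ← div_eq_mul_inv]
      refine sub_le_sub_right ((le_div_iff₀ (pow_pos h0 _)).mpr ?_) 1
      rw [← pow_succ']
      exact pow_le_pow_right₀ h1.le hn
    -- `t` loses at least `N - 1` at `q` and gains at most 1 at any other profile; the lower bound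
    -- sums to `N` minus the number of profiles, which is 2.
    have h5 : ∑ q', (if q' = q then N - 1 else -1 : ℝ) ≤ ∑ q', d q' := by
      refine Finset.sum_le_sum fun q' _ => ?_
      split_ifs with e
      · rw [e]
        exact h4
      · exact hdge q'
    refine le_trans ?_ h5
    have h6 : ∑ q', (if q' = q then N - 1 else -1 : ℝ) =
        ∑ q', ((if q' = q then N else 0) + -1) :=
      Finset.sum_congr rfl fun q' _ => by split_ifs <;> ring
    have h7 : N = Fintype.card (G.OppStrategy i) + 2 := rfl
    rw [h6]
    simp only [Finset.sum_add_distrib, Finset.sum_ite_eq', Finset.mem_univ, if_true,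
      Finset.sum_const, Finset.card_univ, nsmul_eq_mul]
    linarith

/-- A strategy that is a best reply in `P` to some weights on `Q` is not B-dominated. -/
theorem not_bDominated_of_weights {i : I} {v : G.Outcome → ℝ} (hv : v ∈ G.utilities i)
    {P : Set (G.Strategy i)} {Q : Set (G.OppStrategy i)} {s : G.Strategy i}
    {w : G.OppStrategy i → ℝ} (hw : ∀ q, 0 ≤ w q) (hwQ : ∀ q ∉ Q, w q = 0)
    (hne : ∃ q, 0 < w q) (hs : ∀ t ∈ P, G.expUtility i v w t ≤ G.expUtility i v w s) :
    s ∉ G.bDominated i P Q := by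
  rintro ⟨hsP, hdom⟩
  -- On the support of `w`, a weak dominator would have strictly higher expected utility.
  refine hdom {q | 0 < w q} (fun q hq => ?_) hne ⟨hsP, ?_⟩
  · by_contra hn
    exact (hwQ q hn).not_gt hq
  · rintro ⟨t, ht, hle, q, hq, hlt⟩
    refine absurd (hs t ht) (not_le.mpr (Finset.sum_lt_sum (fun q' _ => ?_) ⟨q, by simp, ?_⟩))
    · rcases (hw q').eq_or_lt with h | h
      · simp [← h]
      · exact mul_le_mul_of_nonneg_left ((hv _ _).mpr (hle q' h)) h.le
    · exact mul_lt_mul_of_pos_left ((utility_lt_iff hv _ _).mpr hlt) hq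

theorem mixedDominated_of_bDominated {i : I} {v : G.Outcome → ℝ} (hv : v ∈ G.utilities i)
    {P : Set (G.Strategy i)} {Q : Set (G.OppStrategy i)} (hQ : Q.Nonempty) {s : G.Strategy i}
    (hs : s ∈ G.bDominated i P Q) : s ∈ G.mixedDominated i v P Q := by
  classical
  refine ⟨hs.1, ?_⟩
  obtain ⟨σ, hσ, hP, hlt⟩ := exists_mixture_gt P (fun t q => v (G.play i t q)) s
    (Set.toFinite Q).toFinset (by simpa using hQ) fun Q' hQ' hne => by
      have hsub : (Q' : Set (G.OppStrategy i)) ⊆ Q := fun q hq => by simpa using hQ' hq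
      by_contra hcon
      refine hs.2 Q' hsub (by simpa using hne) ⟨hs.1, ?_⟩
      rintro ⟨t, ht, h1, q, hq, h2⟩
      exact hcon ⟨t, ht, fun q hq => (hv _ _).mpr (h1 q (by simpa using hq)), q,
        by simpa using hq, (utility_lt_iff hv _ _).mpr h2⟩
  exact ⟨σ, hσ, hP, fun q hq => hlt q (by simpa using hq)⟩

/-- Averaged over `w`, a dominating mixture would earn more than `s`, although each pure strategy in
its support earns at most as much. -/
theorem not_mixedDominated_of_weights {i : I} {v : G.Outcome → ℝ}
    {P : Set (G.Strategy i)} {Q : Set (G.OppStrategy i)} {s : G.Strategy i}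
    {w : G.OppStrategy i → ℝ} (hw : ∀ q, 0 ≤ w q) (hwQ : ∀ q ∉ Q, w q = 0)
    (hne : ∃ q, 0 < w q) (hs : ∀ t ∈ P, G.expUtility i v w t ≤ G.expUtility i v w s) :
    s ∉ G.mixedDominated i v P Q := by
  rintro ⟨-, σ, hσ, hσP, hlt⟩
  obtain ⟨q₀, hq₀⟩ := hne
  have h1 : G.expUtility i v w s < ∑ q, w q * ∑ t, σ t * v (G.play i t q) := by
    refine Finset.sum_lt_sum (fun q _ => ?_) ⟨q₀, by simp, ?_⟩
    · by_cases hq : q ∈ Q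
      · exact mul_le_mul_of_nonneg_left (hlt q hq).le (hw q)
      · simp [hwQ q hq]
    · have hq : q₀ ∈ Q := by
        by_contra hn
        exact (hwQ q₀ hn).not_gt hq₀
      exact mul_lt_mul_of_pos_left (hlt q₀ hq) hq₀
  have h2 : ∑ q, w q * ∑ t, σ t * v (G.play i t q) = ∑ t, σ t * G.expUtility i v w t := by
    simp only [expUtility, Finset.mul_sum]
    rw [Finset.sum_comm]
    exact Finset.sum_congr rfl fun t _ => Finset.sum_congr rfl fun q _ => by ring
  have h3 : ∑ t, σ t * G.expUtility i v w t ≤ ∑ t, σ t * G.expUtility i v w s := by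
    refine Finset.sum_le_sum fun t _ => ?_
    by_cases ht : t ∈ P
    · exact mul_le_mul_of_nonneg_left (hs t ht) (hσ.1 t)
    · simp [hσP t ht]
  rw [← Finset.sum_mul, hσ.2, one_mul] at h3
  linarith

theorem opU_eq_iUnion_opM (R : G.Family) (i : I) :
    G.opU R i = ⋃ v ∈ G.utilities i, G.opM i v R := by
  ext s
  simp only [Set.mem_iUnion]
  constructor
  · rintro ⟨hsR, hs⟩
    refine ⟨G.steepUtility i, G.steepUtility_mem i, hsR, fun h hh hne => ?_⟩
    obtain ⟨Q, hQ, ⟨q₀, hq₀⟩, hadm⟩ :=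
      exists_admissible_of_not_bDominated (⟨hsR, hh.2⟩ : s ∈ G.ownAt R i h) (hs h hh hne)
    obtain ⟨w, hpos, hzero, hbest⟩ := exists_weights_of_admissible hadm
    refine not_mixedDominated_of_weights (w := w) (fun q => ?_)
      (fun q hq => hzero q fun h => hq (hQ h)) ⟨q₀, hpos q₀ hq₀⟩ hbest
    by_cases hq : q ∈ Q
    · exact (hpos q hq).le
    · exact (hzero q hq).ge
  · rintro ⟨v, hv, hsR, hs⟩
    exact ⟨hsR, fun h hh hne hb =>
      hs h hh hne (mixedDominated_of_bDominated hv hne.snd hb)⟩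

end

end DynamicGame

/-! ### Order-theoretic tools: lexicographic maxima, kernels and injective keys. -/

theorem exists_lex_max {α : Type*} {T : Set α} (hfin : T.Finite) (hT : T.Nonempty)
    (f : ℕ → α → ℝ) :
    ∃ t ∈ T, ∀ t' ∈ T, ∀ j, (∀ m < j, f m t' = f m t) → f j t' ≤ f j t := by
  obtain ⟨t, ht, hmax⟩ :=
    Set.exists_max_image T (fun t => toLex (fun n => f n t)) hfin hT
  refine ⟨t, ht, fun t' ht' j hj => ?_⟩
  by_contra hn
  exact absurd (hmax t' ht') (not_le.mpr ⟨j, fun m hm => (hj m hm).symm, not_le.mp hn⟩)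

/-- Kernels of relations whose edges decrease a rank exist. -/
theorem exists_kernel {α : Type*} (key : α → ℕ) (r : α → α → Prop) :
    ∃ F : α → Prop, ∀ a, F a ↔ ∀ b, key b < key a → F b → r b a :=
  ⟨(measure key).wf.fix fun a ih => ∀ b (hb : key b < key a), ih b hb → r b a, fun a => by
    rw [WellFounded.fix_eq]⟩

/-- A two-digit number in base `K`: the reversed value of `f` leads, and an enumeration of `α`
breaks ties. Applied to the size of S(h), it lists earlier information sets first. -/
theorem exists_injective_key {α : Type*} [Finite α] (f : α → ℕ) :
    ∃ key : α → ℕ, Function.Injective key ∧ ∀ a b, f a < f b → key b < key a := by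
  obtain ⟨K, ⟨e⟩⟩ := Finite.exists_equiv_fin α
  obtain ⟨M, hM⟩ := (Set.finite_range f).bddAbove
  have hle : ∀ a, f a ≤ M := fun a => hM ⟨a, rfl⟩
  have hlt : ∀ a b, f a < f b → (M - f b) * K + e b < (M - f a) * K + e a := by
    intro a b hab
    have h1 : (M - f b) + 1 ≤ M - f a := by have := hle b; omega
    have h2 := Nat.mul_le_mul_right K h1
    have h3 := (e b).2
    rw [add_mul, one_mul] at h2
    omega
  refine ⟨fun a => (M - f a) * K + e a, fun a b hab => ?_, hlt⟩
  simp only at hab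
  rcases lt_trichotomy (f a) (f b) with h | h | h
  · have := hlt a b h
    omega
  · rw [h] at hab
    exact e.injective (Fin.ext (by omega))
  · have := hlt b a h
    omega

namespace DynamicGame

variable {I : Type*} {A : I → Type*} {G : DynamicGame I A}

instance (i : I) : Finite (G.infoSets i) :=
  G.hist_finite.finite_subsets.subset fun _ hh _ hx => infoSet_mem_hist hh hx

theorem oppAt_mono {R R' : G.Family} (hR : R ≤ R') (i : I) (h : Set (List (∀ i, A i))) :
    G.oppAt R i h ⊆ G.oppAt R' i h := fun _ hq => ⟨fun j => hR j (hq.1 j), hq.2⟩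

/-! ### Conditional probability systems from sequences of weights. -/

section

variable [Finite I]

theorem prob_eq_sum_indicator {i : I} (w : G.OppStrategy i → ℝ) (E : Set (G.OppStrategy i)) :
    G.prob w E = ∑ q, E.indicator w q := by
  classical
  simp only [prob, Set.indicator_apply]

theorem prob_eq_zero_of_forall {i : I} {w : G.OppStrategy i → ℝ} {E : Set (G.OppStrategy i)}
    (h : ∀ q ∈ E, w q = 0) : G.prob w E = 0 := by
  rw [prob_eq_sum_indicator]
  exact Finset.sum_eq_zero fun q _ => Set.indicator_apply_eq_zero.mpr (h q)

theorem prob_pos {i : I} {w : G.OppStrategy i → ℝ} (hw : ∀ q, 0 ≤ w q)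
    {E : Set (G.OppStrategy i)} (h : ∃ q ∈ E, 0 < w q) : 0 < G.prob w E := by
  obtain ⟨q, hq, hpos⟩ := h
  rw [prob_eq_sum_indicator]
  refine Finset.sum_pos' (fun q' _ => Set.indicator_nonneg (fun q _ => hw q) q')
    ⟨q, Finset.mem_univ q, ?_⟩
  rwa [Set.indicator_of_mem hq]

theorem prob_const_mul_indicator {i : I} (w : G.OppStrategy i → ℝ) (c : ℝ)
    {E C : Set (G.OppStrategy i)} (hEC : E ⊆ C) :
    G.prob (fun q => c * C.indicator w q) E = c * G.prob w E := by
  rw [prob_eq_sum_indicator, prob_eq_sum_indicator, Finset.mul_sum]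
  refine Finset.sum_congr rfl fun q _ => ?_
  by_cases hq : q ∈ E
  · simp [hq, hEC hq]
  · simp [hq]

theorem eq_zero_of_prob_eq_one {i : I} {w : G.OppStrategy i → ℝ}
    (hw : w ∈ stdSimplex ℝ (G.OppStrategy i)) {E : Set (G.OppStrategy i)} (hE : G.prob w E = 1)
    {q : G.OppStrategy i} (hq : q ∉ E) : w q = 0 := by
  have h1 : ∑ q, (w q - E.indicator w q) = 0 := by
    rw [Finset.sum_sub_distrib, hw.2, ← prob_eq_sum_indicator, hE, sub_self]
  have h2 := (Finset.sum_eq_zero_iff_of_nonneg fun q _ =>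
    sub_nonneg.mpr (Set.indicator_le_self' (fun q _ => hw.1 q) q)).mp h1 q (Finset.mem_univ q)
  simpa [hq] using h2

/-- A sequence of weights defines a conditional probability system: condition the first weights
that charge the event. -/
theorem exists_isCPS_of_sequence (i : I) (w : ℕ → G.OppStrategy i → ℝ)
    (hw : ∀ n q, 0 ≤ w n q) (hpos : ∀ C : G.condEvents i, ∃ n, ∃ q ∈ C.1, 0 < w n q) :
    ∃ μ, G.IsCPS i μ ∧ ∀ C : G.condEvents i, ∃ n, (∃ q ∈ C.1, 0 < w n q) ∧
      (∀ m < n, ∀ q ∈ C.1, w m q = 0) ∧ ∃ c > 0, μ C = fun q => c * C.1.indicator (w n) q := by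
  classical
  set n : G.condEvents i → ℕ := fun C => Nat.find (hpos C) with hn
  have hnpos : ∀ C : G.condEvents i, ∃ q ∈ C.1, 0 < w (n C) q := fun C => Nat.find_spec (hpos C)
  have hnmin : ∀ (C : G.condEvents i), ∀ m < n C, ∀ q ∈ C.1, w m q = 0 := by
    intro C m hm q hq
    by_contra hne
    exact Nat.find_min (hpos C) hm ⟨q, hq, lt_of_le_of_ne (hw m q) (Ne.symm hne)⟩
  have hp : ∀ C : G.condEvents i, 0 < G.prob (w (n C)) C.1 := fun C =>
    prob_pos (hw _) (hnpos C)
  refine ⟨fun C q => (G.prob (w (n C)) C.1)⁻¹ * C.1.indicator (w (n C)) q, ?_, fun C =>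
    ⟨n C, hnpos C, hnmin C, _, inv_pos.mpr (hp C), rfl⟩⟩
  constructor
  · refine fun C => ⟨fun q => mul_nonneg (inv_nonneg.mpr (hp C).le)
      (Set.indicator_nonneg (fun q _ => hw _ q) q), ?_⟩
    rw [← Finset.mul_sum, ← prob_eq_sum_indicator]
    exact inv_mul_cancel₀ (hp C).ne'
  · intro C
    rw [prob_const_mul_indicator _ _ subset_rfl]
    exact inv_mul_cancel₀ (hp C).ne'
  · intro C D E hED hDC
    rw [prob_const_mul_indicator _ _ (hED.trans hDC), prob_const_mul_indicator _ _ hDC,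
      prob_const_mul_indicator _ _ hED]
    -- A smaller event cannot be charged sooner. If both are first charged at the same stage, the
    -- chain rule is a cancellation; otherwise `D` is null given `C` and both sides vanish.
    have hle : n C ≤ n D := by
      by_contra hlt
      obtain ⟨q, hq, hpq⟩ := hnpos D
      exact hpq.ne' (hnmin C _ (not_le.mp hlt) q (hDC hq))
    rcases hle.eq_or_lt with e | hlt
    · rw [e]
      have := (hp D).ne'
      field_simp
    · rw [prob_eq_zero_of_forall (hnmin D _ hlt),
        prob_eq_zero_of_forall fun q hq => hnmin D _ hlt q (hED hq)]
      simp

end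

/-! ### Best replies that survive elimination. -/

section

variable [DecidableEq I]

theorem opU_subset (R : G.Family) (i : I) : G.opU R i ⊆ R i := fun _ hs => hs.1

theorem icbd_succ (k : ℕ) : G.icbd (k + 1) = G.opU (G.icbd k) :=
  Function.iterate_succ_apply' _ _ _

theorem icbd_antitone : Antitone G.icbd :=
  antitone_nat_of_succ_le fun k i => by
    rw [icbd_succ]
    exact opU_subset _ i

theorem mem_admissible_of_play_eq {i : I} {P : Set (G.Strategy i)}
    {Q : Set (G.OppStrategy i)} {s t : G.Strategy i} (hs : s ∈ G.admissible i P Q) (ht : t ∈ P)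
    (hst : ∀ q ∈ Q, G.play i t q = G.play i s q) : t ∈ G.admissible i P Q := by
  refine ⟨ht, ?_⟩
  rintro ⟨r, hr, hle, q, hq, hlt⟩
  exact hs.2 ⟨r, hr, fun q hq => hst q hq ▸ hle q hq, q, hq, hst q hq ▸ hlt⟩

variable [Finite I]

theorem expUtility_congr {i : I} {v : G.Outcome → ℝ} {w : G.OppStrategy i → ℝ}
    {s t : G.Strategy i} (h : ∀ q, w q ≠ 0 → G.play i s q = G.play i t q) :
    G.expUtility i v w s = G.expUtility i v w t := by
  refine Finset.sum_congr rfl fun q _ => ?_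
  by_cases hq : w q = 0
  · simp [hq]
  · rw [h q hq]

/-- Profiles outside `C` contribute equally to both sides. -/
theorem expUtility_indicator_le_iff {i : I} {v : G.Outcome → ℝ} {w : G.OppStrategy i → ℝ}
    {C : Set (G.OppStrategy i)} {s t : G.Strategy i}
    (h : ∀ q ∉ C, G.play i s q = G.play i t q) :
    G.expUtility i v (C.indicator w) s ≤ G.expUtility i v (C.indicator w) t ↔
      G.expUtility i v w s ≤ G.expUtility i v w t := by
  rw [← sub_nonneg, ← sub_nonneg (b := G.expUtility i v w s)]
  simp only [expUtility, ← Finset.sum_sub_distrib]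
  refine iff_of_eq (congrArg _ (Finset.sum_congr rfl fun q _ => ?_))
  by_cases hq : q ∈ C
  · simp [hq]
  · simp [hq, h q hq]

/-- A best reply at `g` remains a best reply at `h`, if `h` comes after `g`. -/
theorem expUtility_indicator_le_of_best {i : I} {v : G.Outcome → ℝ} {w : G.OppStrategy i → ℝ}
    {g h : Set (List (∀ i, A i))} (hh : h ∈ G.infoSets i) (hgh : G.reach h ⊆ G.reach g)
    {s : G.Strategy i} (hsh : s ∈ G.reachOwn i h)
    (hs : ∀ t ∈ G.reachOwn i g, G.expUtility i v w t ≤ G.expUtility i v w s)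
    {t : G.Strategy i} (ht : t ∈ G.reachOwn i h) :
    G.expUtility i v ((G.reachOpp i h).indicator w) t ≤
      G.expUtility i v ((G.reachOpp i h).indicator w) s := by
  obtain ⟨r, hr1, hr2⟩ := exists_replacement hh hsh ht
  have hr := hs r (reachOwn_mono hgh (mem_reachOwn_of_play_eq hh ht hr1))
  rw [expUtility_congr (s := t) (t := r) fun q hq =>
    (hr1 q (Set.mem_of_indicator_ne_zero hq)).symm]
  exact (expUtility_indicator_le_iff hr2).mpr hr

/-- Let `s` survive `k` rounds and reach `h`. If at every earlier information set `s` is a best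
reply to some beliefs that exclude `h`, then every belief at `h` on the opponents' strategies
that survive `k` rounds has a best reply that survives `k` rounds. -/
theorem exists_best_mem_icbd {i : I} {v : G.Outcome → ℝ} (hv : v ∈ G.utilities i) {k : ℕ}
    {s : G.Strategy i} (hs : s ∈ G.icbd k i) {h : Set (List (∀ i, A i))}
    (hh : h ∈ G.infoSets i) (hsh : s ∈ G.reachOwn i h) {w : G.OppStrategy i → ℝ}
    (hw : ∀ q, 0 ≤ w q) (hwR : ∀ q, w q ≠ 0 → q ∈ G.oppAt (G.icbd k) i h)
    (hpre : ∀ g ∈ G.infoSets i, G.reach h ⊂ G.reach g → ∃ w' : G.OppStrategy i → ℝ,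
      (∀ q, 0 ≤ w' q) ∧ (∃ q, 0 < w' q) ∧
      (∀ q, w' q ≠ 0 → q ∈ G.oppAt (G.icbd k) i g ∧ q ∉ G.reachOpp i h) ∧
      ∀ t ∈ G.reachOwn i g, G.expUtility i v w' t ≤ G.expUtility i v w' s) :
    ∃ t ∈ G.ownAt (G.icbd k) i h,
      ∀ t' ∈ G.reachOwn i h, G.expUtility i v w t' ≤ G.expUtility i v w t := by
  classical
  -- After `w` come uniform weights on the opponents' profiles surviving k, k - 1, ... rounds; round
  -- m sits at position k - m + 1.
  let W : ℕ → G.OppStrategy i → ℝ := fun n =>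
    n.casesOn w fun n => {q | ∀ j : {j // j ≠ i}, q j ∈ G.icbd (k - n) j}.indicator 1
  have hW : ∀ n q, 0 ≤ W n q := by
    intro n q
    cases n with
    | zero => exact hw q
    | succ n => exact Set.indicator_nonneg (fun _ _ => zero_le_one) q
  -- Only play from `h` on is free: against profiles that miss `h`, outcomes stay those of `s`.
  let T : Set (G.Strategy i) :=
    {t | t ∈ G.reachOwn i h ∧ ∀ q ∉ G.reachOpp i h, G.play i t q = G.play i s q}
  obtain ⟨t, ⟨hth, hts⟩, hmax⟩ := exists_lex_max (Set.toFinite T) ⟨s, hsh, fun _ _ => rfl⟩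
    fun n t => G.expUtility i v (W n) t
  -- Replacing `t` from `g` on stays in `T` and leaves the criteria before `j` unchanged, since they
  -- do not charge the event of `g`; lexicographic maximality then bounds criterion `j`.
  have key : ∀ g ∈ G.infoSets i, G.reach g ⊆ G.reach h → t ∈ G.reachOwn i g →
      ∀ j, (∀ m < j, ∀ q ∈ G.reachOpp i g, W m q = 0) → ∀ t' ∈ G.reachOwn i g,
      G.expUtility i v ((G.reachOpp i g).indicator (W j)) t' ≤
        G.expUtility i v ((G.reachOpp i g).indicator (W j)) t := by
    intro g hg hgh htg j hj t' ht'
    obtain ⟨r, hr1, hr2⟩ := exists_replacement hg htg ht'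
    have hrT : r ∈ T := ⟨reachOwn_mono hgh (mem_reachOwn_of_play_eq hg ht' hr1), fun q hq => by
      rw [hr2 q fun e => hq (reachOpp_mono hgh e), hts q hq]⟩
    have hr := hmax r hrT j fun m hm => expUtility_congr fun q hq =>
      hr2 q fun e => hq (hj m hm q e)
    rw [expUtility_congr (s := t') (t := r) fun q hq =>
      (hr1 q (Set.mem_of_indicator_ne_zero hq)).symm]
    exact (expUtility_indicator_le_iff hr2).mpr hr
  have hmem : ∀ m ≤ k, t ∈ G.icbd m i := by
    intro m
    induction m with
    | zero => exact fun _ => Set.mem_univ t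
    | succ m ih =>
      intro hm
      have htm := ih (by omega)
      have hsm := icbd_antitone hm i hs
      rw [icbd_succ] at hsm ⊢
      refine ⟨htm, fun g hg hne => ?_⟩
      obtain ⟨q₀, hq₀⟩ := hne.snd
      -- First case, `g` at or after `h`: `t` is justified by the first weights charging the event
      -- of `g`. They come no later than round `m`, so their support survives `m` rounds.
      by_cases hgh : G.reach g ⊆ G.reach h
      · have hWm : ∃ q ∈ G.reachOpp i g, W (k - m + 1) q ≠ 0 := by
          refine ⟨q₀, hq₀.2, ?_⟩
          have e : k - (k - m) = m := by omega
          have : q₀ ∈ {q : G.OppStrategy i |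
              ∀ j : {j // j ≠ i}, q j ∈ G.icbd (k - (k - m)) j} := by
            rw [e]
            exact hq₀.1
          simp only [W, Set.indicator_of_mem this]
          exact one_ne_zero
        obtain ⟨n, hle, ⟨q₁, hq₁, hq₁'⟩, hmin⟩ : ∃ n ≤ k - m + 1,
            (∃ q ∈ G.reachOpp i g, W n q ≠ 0) ∧
              ∀ n' < n, ∀ q ∈ G.reachOpp i g, W n' q = 0 := by
          have hex : ∃ n, ∃ q ∈ G.reachOpp i g, W n q ≠ 0 := ⟨k - m + 1, hWm⟩
          refine ⟨Nat.find hex, Nat.find_min' hex hWm, Nat.find_spec hex, fun n hn q hq => ?_⟩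
          by_contra hne
          exact Nat.find_min hex hn ⟨q, hq, hne⟩
        have hsupp : ∀ q, W n q ≠ 0 → ∀ j : {j // j ≠ i}, q j ∈ G.icbd m j := by
          intro q hq
          cases n with
          | zero => exact (oppAt_mono (icbd_antitone (by omega)) i h (hwR q hq)).1
          | succ n =>
            intro j
            exact icbd_antitone (by omega : m ≤ k - n) j.1 (Set.mem_of_indicator_ne_zero hq j)
        refine not_bDominated_of_weights hv
          (w := (G.reachOpp i g).indicator (W n))
          (fun q => Set.indicator_nonneg (fun q _ => hW _ q) q) (fun q hq => ?_)
          ⟨q₁, ?_⟩ fun t' ht' => key g hg.1 hgh hg.2 _ hmin t' ht'.2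
        · by_contra hn
          have h1 := Set.mem_of_indicator_ne_zero hn
          rw [Set.indicator_of_mem h1] at hn
          exact hq ⟨hsupp q hn, h1⟩
        · rw [Set.indicator_of_mem hq₁]
          exact lt_of_le_of_ne (hW _ _) (Ne.symm hq₁')
      · by_cases hhg : G.reach h ⊆ G.reach g
        -- `g` strictly before `h`: the given beliefs exclude `h`, where alone `t` and `s` may
        -- differ.
        · obtain ⟨w', hw', hpos, hsupp, hbest⟩ := hpre g hg.1 ⟨hhg, hgh⟩
          refine not_bDominated_of_weights hv hw' (fun q hq => ?_) hpos fun t' ht' => ?_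
          · by_contra hn
            exact hq (oppAt_mono (icbd_antitone (by omega)) i g (hsupp q hn).1)
          · rw [expUtility_congr (s := t) (t := s) fun q hq => hts q (hsupp q hq).2]
            exact hbest t' ht'.2
        -- `g` unordered with `h`: no profile using `t` reaches both, so `t` inherits admissibility
        -- from `s`.
        · have hdisj : ∀ q ∈ G.reachOpp i g, G.play i t q = G.play i s q := by
            refine fun q hq => hts q fun hqh => ?_
            rcases reach_subset_or_subset hg.1 hh
              ((join_mem_reach_iff hg.1).mpr ⟨hg.2, hq⟩)
              ((join_mem_reach_iff hh).mpr ⟨hth, hqh⟩) with e | e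
            · exact hhg e
            · exact hgh e
          have hsg : s ∈ G.reachOwn i g :=
            mem_reachOwn_of_play_eq hg.1 hg.2 fun q hq => (hdisj q hq).symm
          obtain ⟨Q, hQ, hQne, hadm⟩ := exists_admissible_of_not_bDominated
            (⟨hsm.1, hsg⟩ : s ∈ G.ownAt (G.icbd m) i g)
            (hsm.2 g ⟨hg.1, hsg⟩ ⟨(s, q₀), ⟨hsm.1, hsg⟩, hq₀⟩)
          intro hb
          exact hb.2 Q hQ hQne (mem_admissible_of_play_eq hadm ⟨htm, hg.2⟩
            fun q hq => hdisj q (hQ hq).2)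
  refine ⟨t, ⟨hmem k le_rfl, hth⟩, fun t' ht' => ?_⟩
  have h1 := key h hh subset_rfl hth 0 (fun m hm => absurd hm (Nat.not_lt_zero m)) t' ht'
  have h2 : (G.reachOpp i h).indicator (W 0) = w :=
    Set.indicator_eq_self.mpr fun q hq => (hwR q hq).2
  rwa [h2] at h1

/-! ### Agreement of 𝕌 and 𝐑 along the iteration. -/

/-- The conditional belief at h is itself a system of weights on R_{-i}(h) that makes `s` a best
reply. -/
theorem opR_subset_opU {u : I → G.Outcome → ℝ} (hu : ∀ i, u i ∈ G.utilities i) (R : G.Family)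
    (i : I) : G.opR u R i ⊆ G.opU R i := by
  rintro s ⟨hsR, μ, ⟨hμ, hμR⟩, hs⟩
  refine ⟨hsR, fun h hh hne => ?_⟩
  have hsx := hμ.mem_simplex (G.eventAt i ⟨h, hh.1⟩)
  refine not_bDominated_of_weights (hu i) (w := μ (G.eventAt i ⟨h, hh.1⟩)) hsx.1
    (fun q hq => eq_zero_of_prob_eq_one hsx (hμR ⟨h, hh.1⟩ hne) hq) ?_ fun t ht => ?_
  · by_contra! hn
    have := Finset.sum_nonpos fun q (_ : q ∈ Finset.univ) => hn q
    rw [hsx.2] at this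
    linarith
  · have := hs ⟨h, hh.1⟩ hh hne t ht.2
    simpa only [condUtility, expUtility, mul_comm] using this

theorem opU_icbd_subset_opR (k : ℕ) (i : I) :
    G.opU (G.icbd k) i ⊆ G.opR G.steepUtility (G.icbd k) i := by
  classical
  rintro s ⟨hsR, hs⟩
  set R := G.icbd k
  set v := G.steepUtility i
  -- Where `s` does not reach `a`, or no opponents' profile in `R` does, the weights are 0 and block
  -- no later set.
  have hlam : ∀ a : G.infoSets i, ∃ w : G.OppStrategy i → ℝ, (∀ q, 0 ≤ w q) ∧
      (∀ q, w q ≠ 0 → q ∈ G.oppAt R i a.1 ∧ s ∈ G.reachOwn i a.1) ∧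
      (s ∈ G.reachOwn i a.1 → (G.oppAt R i a.1).Nonempty → (∃ q, 0 < w q) ∧
        ∀ t ∈ G.ownAt R i a.1, G.expUtility i v w t ≤ G.expUtility i v w s) := by
    intro a
    by_cases ha : s ∈ G.reachOwn i a.1 ∧ (G.oppAt R i a.1).Nonempty
    · obtain ⟨Q, hQ, ⟨q₀, hq₀⟩, hadm⟩ := exists_admissible_of_not_bDominated
        (⟨hsR, ha.1⟩ : s ∈ G.ownAt R i a.1)
        (hs a.1 ⟨a.2, ha.1⟩ (Set.Nonempty.prod ⟨s, hsR, ha.1⟩ ha.2))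
      obtain ⟨w, hpos, hzero, hbest⟩ := exists_weights_of_admissible hadm
      refine ⟨w, fun q => ?_, fun q hq => ⟨hQ ?_, ha.1⟩, fun _ _ => ⟨⟨q₀, hpos q₀ hq₀⟩, hbest⟩⟩
      · by_cases hq : q ∈ Q
        · exact (hpos q hq).le
        · exact (hzero q hq).ge
      · by_contra hn
        exact hq (hzero q hn)
    · exact ⟨0, fun _ => le_rfl, fun q hq => absurd rfl hq, fun h1 h2 => absurd ⟨h1, h2⟩ ha⟩
  choose l hl0 hlsupp hlbest using hlam
  obtain ⟨key, hinj, hkey⟩ := exists_injective_key fun a : G.infoSets i => (G.reach a.1).ncard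
  have hkey' : ∀ a b : G.infoSets i, G.reach a.1 ⊂ G.reach b.1 → key b < key a := fun a b hab =>
    hkey a b (Set.ncard_lt_ncard hab (Set.toFinite _))
  -- `F` selects the sets whose weights are kept: those whose event is charged by no weights kept
  -- before.
  obtain ⟨F, hF⟩ := exists_kernel key fun b a => ∀ q ∈ G.reachOpp i a.1, l b q = 0
  have hind : ∀ a : G.infoSets i, (G.reachOpp i a.1).indicator (l a) = l a := fun a =>
    Set.indicator_eq_self.mpr fun q hq => (hlsupp a q hq).1.2
  have claim : ∀ n, ∀ a : G.infoSets i, key a = n → s ∈ G.reachOwn i a.1 →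
      (G.oppAt R i a.1).Nonempty → ∃ b, F b ∧ key b ≤ key a ∧
      (∃ q ∈ G.reachOpp i a.1, 0 < l b q) ∧
      (∀ b', F b' → key b' < key b → ∀ q ∈ G.reachOpp i a.1, l b' q = 0) ∧
      ∀ t ∈ G.reachOwn i a.1, G.expUtility i v ((G.reachOpp i a.1).indicator (l b)) t ≤
        G.expUtility i v ((G.reachOpp i a.1).indicator (l b)) s := by
    intro n
    induction n using Nat.strong_induction_on with
    | _ n ih =>
      rintro a rfl hsa hRa
      by_cases hFa : F a
      · obtain ⟨⟨q₀, hq₀⟩, hbest⟩ := hlbest a hsa hRa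
        refine ⟨a, hFa, le_rfl, ⟨q₀, (hlsupp a q₀ hq₀.ne').1.2, hq₀⟩,
          fun b hb hlt => (hF a).mp hFa b hlt hb, fun t ht => ?_⟩
        rw [hind]
        -- `l a` makes `s` optimal only among survivors; a surviving overall best reply closes the
        -- gap. At earlier sets the induction supplies kept weights, which miss the event of `a`
        -- because `a` is in `F`.
        obtain ⟨t', ht', hmax⟩ := exists_best_mem_icbd (G.steepUtility_mem i) hsR a.2 hsa (hl0 a)
          (fun q hq => (hlsupp a q hq).1) fun g hg hag => by
            obtain ⟨q, hq⟩ := hRa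
            obtain ⟨b, hb, hbg, ⟨q₁, hq₁, hpos⟩, -, hopt⟩ := ih (key ⟨g, hg⟩)
              (hkey' a ⟨g, hg⟩ hag) ⟨g, hg⟩ rfl (reachOwn_mono hag.1 hsa)
              ⟨q, hq.1, reachOpp_mono hag.1 hq.2⟩
            refine ⟨_, fun q => Set.indicator_nonneg (fun q _ => hl0 b q) q, ⟨q₁, ?_⟩,
              fun q hq => ?_, hopt⟩
            · rwa [Set.indicator_of_mem hq₁]
            · have h1 := Set.mem_of_indicator_ne_zero hq
              rw [Set.indicator_of_mem h1] at hq
              exact ⟨⟨(hlsupp b q hq).1.1, h1⟩, fun hqa =>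
                hq ((hF a).mp hFa b (hbg.trans_lt (hkey' a ⟨g, hg⟩ hag)) hb q hqa)⟩
        exact (hmax t ht).trans (hbest t' ht')
      -- Here `a` inherits the first kept weights charging its event, from some `b`. One profile
      -- using `s` reaches both sets, so `b` precedes `a`; as `b` is in `F`, the induction at `b`
      -- returns `b` itself, and optimality passes down to `a`.
      · have hex : ∃ m, ∃ b, key b = m ∧ key b < key a ∧ F b ∧
            ∃ q ∈ G.reachOpp i a.1, l b q ≠ 0 := by
          by_contra! hn
          exact hFa ((hF a).mpr fun b hlt hb => hn _ b rfl hlt hb)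
        obtain ⟨b, hbm, hba, hFb, q, hqa, hq⟩ := Nat.find_spec hex
        obtain ⟨hqb, hsb⟩ := hlsupp b q hq
        have hab : G.reach a.1 ⊆ G.reach b.1 := by
          by_contra hn
          rcases reach_subset_or_subset a.2 b.2 ((join_mem_reach_iff a.2).mpr ⟨hsa, hqa⟩)
            ((join_mem_reach_iff b.2).mpr ⟨hsb, hqb.2⟩) with e | e
          · exact absurd (hkey' b a ⟨e, hn⟩) hba.not_gt
          · exact hn e
        obtain ⟨b', hFb', hb'b, ⟨q₁, hq₁, hpos⟩, -, hopt⟩ := ih (key b) hba b rfl hsb ⟨q, hqb⟩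
        have hbb' : b' = b := by
          refine hinj (hb'b.eq_or_lt.resolve_right fun hlt => ?_)
          exact hpos.ne' ((hF b).mp hFb b' hlt hFb' q₁ hq₁)
        subst hbb'
        rw [hind] at hopt
        refine ⟨b', hFb, hba.le, ⟨q, hqa, lt_of_le_of_ne (hl0 b' q) (Ne.symm hq)⟩,
          fun c hc hlt q' hq' => ?_, fun t ht =>
            expUtility_indicator_le_of_best a.2 hab hsa hopt ht⟩
        by_contra hne
        rw [hbm] at hlt
        exact Nat.find_min hex hlt ⟨c, rfl, (hbm ▸ hlt).trans hba, hc, q', hq', hne⟩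
  obtain ⟨B, hB⟩ := (Set.finite_range key).bddAbove
  have hkB : ∀ a, key a < B + 1 := fun a => Nat.lt_succ_of_le (hB ⟨a, rfl⟩)
  -- Kept weights sit at their keys, with zeros in the gaps. Position `B + 1` charges all profiles
  -- in `R`, so beliefs stay on `R` wherever possible; position `B + 2` charges every event, so the
  -- CPS is total.
  let W : ℕ → G.OppStrategy i → ℝ := fun n =>
    if hn : ∃ a, key a = n ∧ F a then l hn.choose
    else if n < B + 1 then 0
    else if n = B + 1 then {q | ∀ j : {j // j ≠ i}, q j ∈ R j}.indicator 1 else 1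
  have hWkey : ∀ a, F a → W (key a) = l a := by
    intro a ha
    have hn : ∃ b, key b = key a ∧ F b := ⟨a, rfl, ha⟩
    simp only [W, hn, dif_pos]
    rw [hinj hn.choose_spec.1]
  have hWlt : ∀ n < B + 1, ∀ q, W n q ≠ 0 → ∃ a, key a = n ∧ F a ∧ l a q ≠ 0 := by
    intro n hn q hq
    by_cases hex : ∃ a, key a = n ∧ F a
    · obtain ⟨a, rfl, ha⟩ := hex
      rw [hWkey a ha] at hq
      exact ⟨a, rfl, ha, hq⟩
    · have e : W n = 0 := (dif_neg hex).trans (if_pos hn)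
      exact absurd (congrFun e q) hq
  have hno : ∀ n, B + 1 ≤ n → ¬ ∃ a, key a = n ∧ F a := by
    rintro n hn ⟨a, rfl, -⟩
    exact absurd (hkB a) (not_lt.mpr hn)
  have hWB : W (B + 1) = {q | ∀ j : {j // j ≠ i}, q j ∈ R j}.indicator 1 :=
    (dif_neg (hno (B + 1) le_rfl)).trans ((if_neg (lt_irrefl _)).trans (if_pos rfl))
  have hWB' : W (B + 2) = 1 :=
    (dif_neg (hno (B + 2) (by omega))).trans
      ((if_neg (by omega)).trans (if_neg (by omega)))
  have hW0 : ∀ n q, 0 ≤ W n q := by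
    intro n q
    simp only [W]
    split_ifs with h1 h2 h3
    · exact hl0 _ q
    · exact le_rfl
    · exact Set.indicator_nonneg (fun _ _ => zero_le_one) q
    · exact zero_le_one
  obtain ⟨μ, hμ, hμW⟩ := exists_isCPS_of_sequence i W hW0 fun C => by
    obtain ⟨_, h, hh, rfl⟩ := C
    obtain ⟨q, hq⟩ := reachOpp_nonempty hh
    exact ⟨B + 2, q, hq, by rw [hWB']; exact one_pos⟩
  refine ⟨hsR, μ, ⟨hμ, fun h hne => ?_⟩, fun h hh hne t ht => ?_⟩
  · obtain ⟨n, -, hmin, c, hc, e⟩ := hμW (G.eventAt i h)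
    obtain ⟨q₀, hq₀⟩ := hne.snd
    have hn : n ≤ B + 1 := by
      by_contra hlt
      have := hmin (B + 1) (not_le.mp hlt) q₀ hq₀.2
      rw [hWB, Set.indicator_of_mem hq₀.1] at this
      exact one_ne_zero this
    have hsupp : ∀ q, W n q ≠ 0 → ∀ j : {j // j ≠ i}, q j ∈ R j := by
      intro q hq
      rcases hn.eq_or_lt with rfl | hlt
      · rw [hWB] at hq
        exact Set.mem_of_indicator_ne_zero hq
      · obtain ⟨a, -, -, ha⟩ := hWlt n hlt q hq
        exact (hlsupp a q ha).1.1
    rw [← hμ.prob_self (G.eventAt i h), prob_eq_sum_indicator, prob_eq_sum_indicator]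
    refine Finset.sum_congr rfl fun q _ => ?_
    by_cases hq : q ∈ G.oppAt R i h.1
    · rw [Set.indicator_of_mem hq, Set.indicator_of_mem (show q ∈ (G.eventAt i h).1 from hq.2)]
    · rw [Set.indicator_of_notMem hq]
      symm
      refine Set.indicator_apply_eq_zero.mpr fun hqC => ?_
      have : W n q = 0 := by
        by_contra hn
        exact hq ⟨hsupp q hn, hqC⟩
      simp [e, this]
  · obtain ⟨b, hFb, -, ⟨q₁, hq₁, hpos⟩, hminb, hopt⟩ := claim _ h rfl hh.2 hne.snd
    obtain ⟨n, ⟨q₂, hq₂, hpos₂⟩, hmin, c, hc, e⟩ := hμW (G.eventAt i h)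
    -- The CPS uses the first weights charging the event, and `b` carries the first kept ones.
    have hn : n = key b := by
      rcases lt_trichotomy n (key b) with hlt | heq | hlt
      · obtain ⟨a, rfl, hFa, ha⟩ := hWlt n (hlt.trans (hkB b)) q₂ hpos₂.ne'
        exact absurd (hminb a hFa hlt q₂ hq₂) ha
      · exact heq
      · have := hmin _ hlt q₁ hq₁
        rw [hWkey b hFb] at this
        exact absurd this hpos.ne'
    rw [hn, hWkey b hFb] at e
    have hcond : ∀ r, G.condUtility i v μ h r =
        c * G.expUtility i v ((G.reachOpp i h.1).indicator (l b)) r := by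
      intro r
      rw [condUtility, expUtility, Finset.mul_sum, e]
      exact Finset.sum_congr rfl fun q _ => by
        change _ * (c * (G.reachOpp i h.1).indicator (l b) q) = _
        ring
    rw [hcond, hcond]
    exact mul_le_mul_of_nonneg_left (hopt t ht) hc.le

theorem strongRat_steepUtility (k : ℕ) : G.strongRat G.steepUtility k = G.icbd k := by
  induction k with
  | zero => rfl
  | succ k ih =>
    have h : G.strongRat G.steepUtility (k + 1) =
        G.opR G.steepUtility (G.strongRat G.steepUtility k) :=
      Function.iterate_succ_apply' _ _ _
    rw [h, ih, icbd_succ]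
    funext i
    exact Set.Subset.antisymm (opR_subset_opU G.steepUtility_mem _ i) (opU_icbd_subset_opR k i)

end

end DynamicGame

theorem mainTheorem2 {I : Type*} [Finite I] [DecidableEq I] {A : I → Type*}
    (G : DynamicGame I A) :
    (∀ (R : G.Family), G.IsRestriction R → ∀ i : I,
      G.opU R i = ⋃ v ∈ G.utilities i, G.opM i v R) ∧
    (∀ k : ℕ, ∃ u : I → G.Outcome → ℝ, (∀ i, u i ∈ G.utilities i) ∧
      G.profiles (G.icbd k) = G.profiles (G.strongRat u k) ∧
      ∀ i, G.icbd k i = G.strongRat u k i) ∧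
    (∃ u : I → G.Outcome → ℝ, (∀ i, u i ∈ G.utilities i) ∧
      G.icbdLimit = G.strongRatLimit u ∧
      ∀ i, G.icbdLimitOf i = G.strongRatLimitOf u i) := by
  refine ⟨fun R _ i => DynamicGame.opU_eq_iUnion_opM R i,
    fun k => ⟨G.steepUtility, G.steepUtility_mem, ?_, fun i => ?_⟩,
    ⟨G.steepUtility, G.steepUtility_mem, ?_, fun i => ?_⟩⟩
  · rw [DynamicGame.strongRat_steepUtility]
  · rw [DynamicGame.strongRat_steepUtility]
  · simp only [DynamicGame.icbdLimit, DynamicGame.strongRatLimit,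
      DynamicGame.strongRat_steepUtility]
  · simp only [DynamicGame.icbdLimitOf, DynamicGame.strongRatLimitOf,
      DynamicGame.strongRat_steepUtility]
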